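/- **Theorem (nestedness).** Let $\Omega\subset\mathbb R^2$ be a bounded polygonal domain with $\Omega=\operatorname{int}\overline\Omega$, let $\mathcal T_0$ be a regular (conforming, without hanging nodes) triangulation of $\overline\Omega$ into finitely many nondegenerate triangles, in each of which one vertex is marked as its newest vertex, and let $k\ge 3$ be an integer. *Meshes.* Newest vertex bisection (NVB) of a triangle joins its newest vertex to the midpoint of the opposite edge (its refinement edge); this midpoint becomes the newest vertex of both children. Let $\mathbb T$ be the set of all regular triangulations obtained from $\mathcal T_0$ by finitely many successive bisections of triangles; intermediate meshes may have hanging nodes. A refinement of $\mathcal T\in\mathbb T$ is a $\hat{\mathcal T}\in\mathbb T$ obtained from $\mathcal T$ by finitely many such bisections. Let $\mathcal V(\mathcal T)$ be the set of vertices of $\mathcal T$ and $\mathcal V_0(\mathcal T)=\mathcal V(\mathcal T)\cap\Omega$. *Stress space.* Let $\mathbb S$ be the space of symmetric real $2\times2$ matrices. For a triangle $K$ with vertices $x_1,x_2,x_3$ and barycentric coordinates $\lambda_1,\lambda_2,\lambda_3$, put $t_{i,j}=x_j-x_i$ and $$\Sigma_{k,b}(K)=\sum_{1\le i<j\le 3}\lambda_i\lambda_j\,P_{k-2}(K;\mathbb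 R)\,t_{i,j}t_{i,j}^T ,$$ where $P_m(K;X)$ denotes the $X$-valued polynomials on $K$ of total degree at most $m$. For $\mathcal T\in\mathbb T$ let $$\Sigma(\mathcal T)=\{\sigma\in H(\operatorname{div},\Omega;\mathbb S)\;:\;\sigma=\sigma_c+\sigma_b,\ \sigma_c\in H^1(\Omega;\mathbb S),\ \sigma_c|_K\in P_k(K;\mathbb S)\text{ and }\sigma_b|_K\in\Sigma_{k,b}(K)\text{ for all }K\in\mathcal T\}.$$ *Extended stress space.* Every $x\in\mathcal V_0(\mathcal T)\setminus\mathcal V(\mathcal T_0)$ is the midpoint of an edge $e$ which is the refinement edge of some triangle generated from $\mathcal T_0$ by successive bisections. Let $t_e$ be a unit tangent of $e$ and $n_e=t_e^\perp$ a unit normal, let $\varphi_x$ be the nodal basis function at $x$ of the continuous scalar Lagrange element of order $k$ on $\mathcal T$, and let $$\omega_x^{\pm}=\bigcup\{K\in\mathcal T\;:\;x\in K,\ \pm(\operatorname{mid}(K)-x)\cdot n_e>0\},$$ where $\operatorname{mid}(K)$ is the barycentre of $K$. Let $\varphi_x^\pm$ equal $\varphi_x$ on $\omega_x^\pm$ and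 $0$ elsewhere. Put $$E(\mathcal T)=\operatorname{span}\{\varphi_x^+\,t_et_e^T,\ \varphi_x^-\,t_et_e^T\;:\;x\in\mathcal V_0(\mathcal T)\setminus\mathcal V(\mathcal T_0)\},\qquad \widetilde\Sigma(\mathcal T)=\Sigma(\mathcal T)+E(\mathcal T).$$ *Claim.* For every $\mathcal T\in\mathbb T$ and every refinement $\hat{\mathcal T}$ of $\mathcal T$, $$\widetilde\Sigma(\mathcal T)\subset\widetilde\Sigma(\hat{\mathcal T}).$$ -/

import Mathlib

open MeasureTheory
open scoped ContDiff

noncomputable section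

namespace NestedStress

/-- The Euclidean plane `ℝ²`. -/
abbrev Plane := EuclideanSpace ℝ (Fin 2)

/-- `2 × 2` matrix fields; they are compared up to equality almost everywhere on the domain. -/
abbrev MatField := Plane → Matrix (Fin 2) (Fin 2) ℝ

/-! ### Triangles and newest vertex bisection -/

/-- A nondegenerate triangle with ordered vertices. The edge from `points 0` to `points 1` is its
refinement edge and `points 2` is its newest vertex. -/
abbrev Tri := Affine.Simplex ℝ Plane 2

namespace Tri

/-- The closed triangle as a set of points. -/
def hull (K : Tri) : Set Plane := convexHull ℝ (Set.range K.points)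

/-- The midpoint of the refinement edge. -/
def refMid (K : Tri) : Plane := midpoint ℝ (K.points 0) (K.points 1)

/-- The barycentre `mid(K)`. -/
def mid (K : Tri) : Plane := (1 / 3 : ℝ) • ∑ i, K.points i

theorem coeff_eq_zero {p : Fin 3 → Plane} (hp : AffineIndependent ℝ p) {a b c : ℝ}
    (h : a + b + c = 0) (h' : a • p 0 + b • p 1 + c • p 2 = 0) : a = 0 ∧ b = 0 ∧ c = 0 := by
  have := affineIndependent_iff.1 hp Finset.univ ![a, b, c]
    (by simpa [Fin.sum_univ_three] using h) (by simpa [Fin.sum_univ_three] using h')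
  exact ⟨by simpa using this 0, by simpa using this 1, by simpa using this 2⟩

theorem indep_of_coeff {p : Fin 3 → Plane}
    (hp : ∀ a b c : ℝ, a + b + c = 0 → a • p 0 + b • p 1 + c • p 2 = 0 →
      a = 0 ∧ b = 0 ∧ c = 0) : AffineIndependent ℝ p := by
  rw [affineIndependent_iff_of_fintype]
  intro w hw h
  rw [Finset.univ.weightedVSub_eq_linear_combination hw] at h
  rw [Fin.sum_univ_three] at hw h
  obtain ⟨h0, h1, h2⟩ := hp _ _ _ hw h
  intro i
  fin_cases i
  · exact h0
  · exact h1
  · exact h2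

theorem left_indep (K : Tri) :
    AffineIndependent ℝ ![K.points 2, K.points 0, K.refMid] := by
  refine indep_of_coeff fun a b c h h' => ?_
  simp only [Matrix.cons_val, refMid, midpoint_eq_smul_add, invOf_eq_inv] at h'
  obtain ⟨h0, h1, h2⟩ := coeff_eq_zero K.independent (a := b + c / 2) (b := c / 2) (c := a)
    (by linarith) (by rw [← h']; module)
  exact ⟨h2, by linarith, by linarith⟩

theorem right_indep (K : Tri) :
    AffineIndependent ℝ ![K.points 1, K.points 2, K.refMid] := by
  refine indep_of_coeff fun a b c h h' => ?_
  simp only [Matrix.cons_val, refMid, midpoint_eq_smul_add, invOf_eq_inv] at h'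
  obtain ⟨h0, h1, h2⟩ := coeff_eq_zero K.independent (a := c / 2) (b := a + c / 2) (c := b)
    (by linarith) (by rw [← h']; module)
  exact ⟨by linarith, h2, by linarith⟩

/-- First child of the bisection: the midpoint of the refinement edge becomes the newest vertex,
and the edge opposite to it becomes the refinement edge. -/
def left (K : Tri) : Tri := ⟨![K.points 2, K.points 0, K.refMid], K.left_indep⟩

/-- Second child of the bisection. -/
def right (K : Tri) : Tri := ⟨![K.points 1, K.points 2, K.refMid], K.right_indep⟩

/-- The barycentric coordinate of `y` with respect to the vertex `points i`. -/
def bary (K : Tri) (i : Fin 3) (y : Plane) : ℝ :=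
  AffineBasis.coord
    ⟨K.points, K.independent, by
      rw [K.independent.affineSpan_eq_top_iff_card_eq_finrank_add_one]; simp⟩ i y

end Tri

/-- The region covered by a mesh. -/
def meshUnion (T : Set Tri) : Set Plane := ⋃ K ∈ T, K.hull

/-- The set of vertices of a mesh. -/
def vertices (T : Set Tri) : Set Plane := {x | ∃ K ∈ T, x ∈ Set.range K.points}

/-- Regular (conforming) meshes: two distinct triangles have distinct vertex sets, and they meet
exactly in the convex hull of their common vertices (so: nothing, one vertex, or one edge). -/
def Conforming (T : Set Tri) : Prop :=
  ∀ K ∈ T, ∀ L ∈ T, K ≠ L →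
    Set.range K.points ≠ Set.range L.points ∧
    K.hull ∩ L.hull = convexHull ℝ (Set.range K.points ∩ Set.range L.points)

/-- `T` is a regular triangulation, into finitely many triangles, of the (closure of the) open
polygonal set `Ω`, where `Ω` is the interior of its closure. -/
def IsTriangulation (Ω : Set Plane) (T : Set Tri) : Prop :=
  T.Finite ∧ Conforming T ∧ closure Ω = meshUnion T ∧ interior (closure Ω) = Ω

/-- `T'` arises from `T` by bisecting one triangle. Intermediate meshes may have hanging nodes. -/
def BisectStep (T T' : Set Tri) : Prop :=
  ∃ K ∈ T, T' = (T \ {K}) ∪ {K.left, K.right}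

/-- `T'` arises from `T` by finitely many successive bisections. -/
def Refines (T T' : Set Tri) : Prop := Relation.ReflTransGen BisectStep T T'

/-- The class `𝕋(T₀)` of regular triangulations obtained from `T₀` by finitely many bisections. -/
def admissible (T₀ : Set Tri) : Set (Set Tri) := {T | Refines T₀ T ∧ Conforming T}

/-- All triangles that can be generated from `T₀` by successive bisections. -/
inductive Generated (T₀ : Set Tri) : Tri → Prop
  | init (K : Tri) : K ∈ T₀ → Generated T₀ K
  | left (K : Tri) : Generated T₀ K → Generated T₀ K.left
  | right (K : Tri) : Generated T₀ K → Generated T₀ K.right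

/-! ### Sobolev spaces -/

/-- Smooth real functions with compact support in `Ω`. -/
def IsTest (Ω : Set Plane) (φ : Plane → ℝ) : Prop :=
  ContDiff ℝ ∞ φ ∧ HasCompactSupport φ ∧ tsupport φ ⊆ Ω

/-- The partial derivative `∂φ/∂x_j`. -/
def partialDeriv (j : Fin 2) (φ : Plane → ℝ) (y : Plane) : ℝ :=
  fderiv ℝ φ y (EuclideanSpace.single j 1)

/-- `u ∈ L²(Ω)`. -/
def MemL2 (Ω : Set Plane) (u : Plane → ℝ) : Prop := MemLp u 2 (volume.restrict Ω)

/-- `u ∈ H¹(Ω)`: `u` and its weak partial derivatives are square integrable. -/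
def MemH1 (Ω : Set Plane) (u : Plane → ℝ) : Prop :=
  MemL2 Ω u ∧ ∀ j, ∃ g, MemL2 Ω g ∧ ∀ φ, IsTest Ω φ →
    ∫ y in Ω, u y * partialDeriv j φ y = -∫ y in Ω, g y * φ y

/-- `σ ∈ H¹(Ω; 𝕊)`, with `𝕊` the symmetric matrices. -/
def MemH1Sym (Ω : Set Plane) (σ : MatField) : Prop :=
  (∀ᵐ y ∂volume.restrict Ω, (σ y).IsSymm) ∧ ∀ i j, MemH1 Ω fun y => σ y i j

/-- `σ ∈ H(div, Ω; 𝕊)`: square integrable symmetric matrix fields whose weak (row-wise)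
divergence is square integrable. -/
def MemHdiv (Ω : Set Plane) (σ : MatField) : Prop :=
  (∀ᵐ y ∂volume.restrict Ω, (σ y).IsSymm) ∧ (∀ i j, MemL2 Ω fun y => σ y i j) ∧
    ∀ i, ∃ d, MemL2 Ω d ∧ ∀ φ, IsTest Ω φ →
      ∫ y in Ω, ∑ j, σ y i j * partialDeriv j φ y = -∫ y in Ω, d y * φ y

/-! ### The stress space -/

/-- Real polynomials in the two coordinates. -/
abbrev Poly := MvPolynomial (Fin 2) ℝ

/-- The value of a polynomial at a point of the plane. -/
def evalAt (y : Plane) (p : Poly) : ℝ := MvPolynomial.eval (fun i => y i) p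

/-- `σ|_K ∈ P_k(K; 𝕊)`. -/
def IsPolySymOn (k : ℕ) (K : Tri) (σ : MatField) : Prop :=
  ∃ P : Matrix (Fin 2) (Fin 2) Poly, P.IsSymm ∧ (∀ i j, (P i j).totalDegree ≤ k) ∧
    ∀ᵐ y ∂volume.restrict K.hull, σ y = P.map (evalAt y)

/-- The rank-one matrix `t tᵀ`. -/
def outer (t : Plane) : Matrix (Fin 2) (Fin 2) ℝ := Matrix.of fun i j => t i * t j

/-- `σ|_K ∈ Σ_{k,b}(K) = ∑_{i<j} λ_i λ_j P_{k-2}(K) t_{ij} t_{ij}ᵀ`, where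
`t_{ij} = x_j - x_i`. -/
def IsBubbleOn (k : ℕ) (K : Tri) (σ : MatField) : Prop :=
  ∃ p : Fin 3 → Fin 3 → Poly, (∀ i j, (p i j).totalDegree ≤ k - 2) ∧
    ∀ᵐ y ∂volume.restrict K.hull,
      σ y = ∑ i, ∑ j ∈ Finset.Ioi i,
        (K.bary i y * K.bary j y * evalAt y (p i j)) • outer (K.points j - K.points i)

/-- The stress space `Σ(T)`. -/
def stressSpace (Ω : Set Plane) (k : ℕ) (T : Set Tri) : Set MatField :=
  {σ | MemHdiv Ω σ ∧ ∃ σc σb : MatField,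
    (∀ᵐ y ∂volume.restrict Ω, σ y = σc y + σb y) ∧ MemH1Sym Ω σc ∧
    ∀ K ∈ T, IsPolySymOn k K σc ∧ IsBubbleOn k K σb}

/-! ### The extended stress space -/

/-- The nodes of the Lagrange element of order `k` on `K`: the points whose barycentric
coordinates are integer multiples of `1/k`. -/
def lagrangeNodes (k : ℕ) (K : Tri) : Set Plane :=
  {z | ∃ a : Fin 3 → ℕ, ∑ i, a i = k ∧ z = ∑ i, ((a i : ℝ) / k) • K.points i}

/-- `φ` is, on the region covered by `T`, the nodal basis function at `x` of the scalar Lagrange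
element of order `k`: on each closed triangle it agrees with a polynomial of degree at most `k`
(hence it is continuous), it is `1` at `x`, and it is `0` at all other nodes. -/
def IsNodalBasis (k : ℕ) (T : Set Tri) (x : Plane) (φ : Plane → ℝ) : Prop :=
  (∀ K ∈ T, ∃ p : Poly, p.totalDegree ≤ k ∧ ∀ y ∈ K.hull, φ y = evalAt y p) ∧
  φ x = 1 ∧ ∀ K ∈ T, ∀ z ∈ lagrangeNodes k K, z ≠ x → φ z = 0

/-- Rotation by a right angle, `t ↦ t^⊥`. -/
def perp (t : Plane) : Plane := !₂[-t 1, t 0]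

/-- The unit tangent `t_e` of the refinement edge of `K`. -/
def edgeTangent (K : Tri) : Plane := ‖K.points 1 - K.points 0‖⁻¹ • (K.points 1 - K.points 0)

/-- The patch of the triangles of `T` at `x` whose barycentre is on the side of `x` to which `n`
points. With `n = n_e` this is `ω⁺`, and with `n = -n_e` it is `ω⁻`. -/
def sidePatch (T : Set Tri) (x n : Plane) : Set Plane :=
  ⋃ K ∈ {K : Tri | K ∈ T ∧ x ∈ K.hull ∧ 0 < inner ℝ (K.mid - x) n}, K.hull

/-- The field equal to `φ t tᵀ` on the set `W` and to zero elsewhere. -/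
def oneSided (W : Set Plane) (φ : Plane → ℝ) (t : Plane) : MatField :=
  W.indicator fun y => φ y • outer t

/-- The span `E(T)` of the one-sided fields `φ⁺ t_e t_eᵀ` and `φ⁻ t_e t_eᵀ`, for the interior
vertices `x` of `T` that are not vertices of `T₀`. Such a vertex is created as the midpoint of the
refinement edge `e` of a generated triangle `K`. -/
def edgeSpace (Ω : Set Plane) (T₀ : Set Tri) (k : ℕ) (T : Set Tri) : Submodule ℝ MatField :=
  Submodule.span ℝ
    {τ | ∃ x ∈ (vertices T ∩ Ω) \ vertices T₀, ∃ K, Generated T₀ K ∧ K.refMid = x ∧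
      ∃ φ, IsNodalBasis k T x φ ∧
        (τ = oneSided (sidePatch T x (perp (edgeTangent K))) φ (edgeTangent K) ∨
         τ = oneSided (sidePatch T x (-perp (edgeTangent K))) φ (edgeTangent K))}

/-- The extended stress space: the sum of `Σ(T)` and `E(T)`. -/
def extendedStressSpace (Ω : Set Plane) (T₀ : Set Tri) (k : ℕ) (T : Set Tri) : Set MatField :=
  {τ | ∃ σ ∈ stressSpace Ω k T, ∃ ε ∈ edgeSpace Ω T₀ k T, τ = σ + ε}

end NestedStress

end

/-!
The claim is additive in the stress, so it suffices to place in the extended space of the fine mesh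
(i) the `H¹` part, (ii) each single bubble `λ_i λ_j p t tᵀ` of a coarse triangle, where `t` is the
direction of the edge `ij`, and (iii) each generator `φ_x^± t_e t_eᵀ` of the coarse mesh. For (i)
nothing has to be done. The fields in (ii) and (iii) have the same shape: a continuous piecewise
polynomial `v` on some triangles on one side of a line `ℓ`, extended by zero, times `t tᵀ` with `t`
the direction of `ℓ`, where the extension by zero jumps across `ℓ` only. This is `OneSidedSpline`.

Such a field is decomposed on the fine mesh by `OneSidedSpline.decomposable`. Subtracting
`v(z) φ_z^+` for all fine vertices `z` on `ℓ` makes `v` vanish at these vertices. On a fine edge on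
`ℓ` the rest then vanishes at both end points, so there it equals `λ_i λ_j q` with `q` of degree
at most `k - 2`; subtracting this bubble, which vanishes on the other two edges, for all edges on
`ℓ` leaves a function that vanishes on `ℓ`. It is continuous, and continuous piecewise polynomials
are in `H¹`.

The functions `φ_z^+ t tᵀ` have to be generators for the fine mesh, that is, `z` must be an interior
vertex, not a vertex of the initial mesh, and the midpoint of a refinement edge on `ℓ`. The last
point is `Tri.Desc.exists_refMid`: a vertex created inside a triangle is the midpoint of a segment
in this triangle, and if it lies on a supporting line then so do both end points. That `z` is
interior follows from `Conforming.edge_neighbor`: two triangles which share an edge lie on opposite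
sides of it. A bubble whose edge is not shared is continuous already. For (iii) one needs moreover
that the line through `e` does not cross the triangles at `x` (`one_sided_of_mem`), and that the
coarse edges at `x` on that line are shared, because `x` is interior (`exists_ne_mem_hull`).

Two facts about weak derivatives are used, and both rest on the integral of a directional derivative
of a compactly supported Lipschitz function being zero. A function that is Lipschitz on each of
finitely many closed sets covering the plane is Lipschitz (`exists_lipschitzWith_of_closed_cover`);
applied to the product with a test function this gives `IsTriangulation.memH1`. For the divergence
of a bubble only the derivative along its edge matters, and the jump across that edge is removed by
a cut-off which is constant in this direction (`Tri.integral_fderiv_eq_zero`). Hence membership in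
`H(div)` is automatic for a sum of a continuous part and a bubble part.
-/

namespace NestedStress

open Tri

/-! ### Barycentric coordinates -/

namespace Tri

/-- The vertices of a triangle as an affine basis of the plane. -/
noncomputable def basis (K : Tri) : AffineBasis (Fin 3) ℝ Plane :=
  ⟨K.points, K.independent, by
    rw [K.independent.affineSpan_eq_top_iff_card_eq_finrank_add_one]; simp⟩

/-- The barycentric coordinate `bary i` as an affine map. -/
noncomputable def baryMap (K : Tri) (i : Fin 3) : Plane →ᵃ[ℝ] ℝ := K.basis.coord i

theorem baryMap_apply (K : Tri) (i : Fin 3) (y : Plane) : K.baryMap i y = K.bary i y := rfl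

theorem mem_hull_iff (K : Tri) (y : Plane) : y ∈ K.hull ↔ ∀ i, 0 ≤ K.bary i y := by
  have := K.basis.convexHull_eq_nonneg_coord
  unfold hull
  rw [show K.points = K.basis from rfl, this]
  rfl

theorem bary_points (K : Tri) (i j : Fin 3) :
    K.bary i (K.points j) = if i = j then 1 else 0 :=
  K.basis.coord_apply i j

theorem sum_bary (K : Tri) (y : Plane) : ∑ i, K.bary i y = 1 :=
  K.basis.sum_coord_apply_eq_one y

theorem sum_bary_smul (K : Tri) (y : Plane) : ∑ i, K.bary i y • K.points i = y :=
  K.basis.linear_combination_coord_eq_self y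

theorem continuous_bary (K : Tri) (i : Fin 3) : Continuous (K.bary i) :=
  continuous_barycentric_coord K.basis i

/-- An affine function is determined by its values at the vertices. -/
theorem affine_eq_sum (K : Tri) (h : Plane →ᵃ[ℝ] ℝ) (y : Plane) :
    h y = ∑ i, K.bary i y * h (K.points i) := by
  have h1 : Finset.univ.affineCombination ℝ K.points (fun i => K.bary i y) = y :=
    K.basis.affineCombination_coord_eq_self y
  have h2 := Finset.univ.map_affineCombination K.points (fun i => K.bary i y) (K.sum_bary y) h
  rw [h1, Finset.univ.affineCombination_eq_linear_combination _ _ (K.sum_bary y)] at h2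
  simpa using h2

theorem points_mem_hull (K : Tri) (i : Fin 3) : K.points i ∈ K.hull :=
  subset_convexHull ℝ _ ⟨i, rfl⟩

theorem convex_hull (K : Tri) : Convex ℝ K.hull := convex_convexHull ℝ _

theorem isCompact_hull (K : Tri) : IsCompact K.hull :=
  (Set.finite_range K.points).isCompact_convexHull (𝕜 := ℝ)

theorem isClosed_hull (K : Tri) : IsClosed K.hull := K.isCompact_hull.isClosed

theorem sum_smul_mem_hull (K : Tri) {w : Fin 3 → ℝ} (hw : ∀ i, 0 ≤ w i) (h1 : ∑ i, w i = 1) :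
    ∑ i, w i • K.points i ∈ K.hull :=
  K.convex_hull.sum_mem (fun i _ => hw i) h1 fun i _ => K.points_mem_hull i

theorem bary_sum_smul (K : Tri) {w : Fin 3 → ℝ} (h1 : ∑ i, w i = 1) (i : Fin 3) :
    K.bary i (∑ j, w j • K.points j) = w i := by
  have := K.basis.coord_apply_combination_of_mem (Finset.mem_univ i) h1
  rwa [Finset.univ.affineCombination_eq_linear_combination _ _ h1] at this

theorem points_injective (K : Tri) : Function.Injective K.points := K.independent.injective

theorem eq_points_of_bary_eq_zero (K : Tri) {y : Plane} {i : Fin 3}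
    (h : ∀ j, j ≠ i → K.bary j y = 0) : y = K.points i := by
  have hs := K.sum_bary y
  rw [Finset.sum_eq_single i (fun j _ hj => h j hj) (by simp)] at hs
  have := K.sum_bary_smul y
  rw [Finset.sum_eq_single i (fun j _ hj => by rw [h j hj, zero_smul]) (by simp), hs,
    one_smul] at this
  exact this.symm

/-- The open triangle: all barycentric coordinates are positive. -/
def Inside (K : Tri) (y : Plane) : Prop := ∀ i, 0 < K.bary i y

theorem Inside.mem_hull {K : Tri} {y : Plane} (h : K.Inside y) : y ∈ K.hull :=
  (K.mem_hull_iff y).2 fun i => (h i).le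

theorem isOpen_inside (K : Tri) : IsOpen {y | K.Inside y} := by
  simp only [Inside, Set.ofPred_forall]
  exact isOpen_iInter_of_finite fun i => isOpen_lt continuous_const (K.continuous_bary i)

theorem inside_mid (K : Tri) : K.Inside K.mid := by
  intro i
  have : K.mid = ∑ i : Fin 3, ((fun _ => 1 / 3 : Fin 3 → ℝ) i) • K.points i := by
    simp [mid, Finset.smul_sum]
  rw [this, bary_sum_smul]
  · norm_num
  · simp

theorem nonneg_of_mem_hull (K : Tri) {h : Plane →ᵃ[ℝ] ℝ} (hK : ∀ i, 0 ≤ h (K.points i))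
    {y : Plane} (hy : y ∈ K.hull) : 0 ≤ h y := by
  rw [K.affine_eq_sum h y]
  exact Finset.sum_nonneg fun i _ => mul_nonneg ((K.mem_hull_iff y).1 hy i) (hK i)

/-- An affine function that is not constantly zero is nonzero at some vertex. -/
theorem exists_ne_zero (K : Tri) {h : Plane →ᵃ[ℝ] ℝ} {y : Plane} (hy : h y ≠ 0) :
    ∃ i, h (K.points i) ≠ 0 := by
  by_contra! hc
  exact hy (by rw [K.affine_eq_sum h y]; simp [hc])

theorem neg_affine_apply (h : Plane →ᵃ[ℝ] ℝ) (y : Plane) : (-h) y = -h y := rfl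

theorem nonpos_of_mem_hull (K : Tri) {h : Plane →ᵃ[ℝ] ℝ} (hK : ∀ i, h (K.points i) ≤ 0)
    {y : Plane} (hy : y ∈ K.hull) : h y ≤ 0 := by
  have := K.nonneg_of_mem_hull (h := -h) (fun j => by
    rw [neg_affine_apply]; linarith [hK j]) hy
  rw [neg_affine_apply] at this
  linarith

theorem pos_of_edge_eq_zero (K : Tri) {h : Plane →ᵃ[ℝ] ℝ} {v : Plane} (hv : h v ≠ 0) {c : Fin 3}
    (hK : 0 ≤ h (K.points c)) (hc : ∀ i, i ≠ c → h (K.points i) = 0) : 0 < h (K.points c) := by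
  obtain ⟨l, hl⟩ := K.exists_ne_zero hv
  have : l = c := by by_contra hne; exact hl (hc l hne)
  exact lt_of_le_of_ne hK (this ▸ hl.symm)

theorem pos_of_inside (K : Tri) {h : Plane →ᵃ[ℝ] ℝ} (hK : ∀ i, 0 ≤ h (K.points i))
    {v : Plane} (hv : h v ≠ 0) {y : Plane} (hy : K.Inside y) : 0 < h y := by
  obtain ⟨i, hi⟩ := K.exists_ne_zero hv
  rw [K.affine_eq_sum h y]
  exact Finset.sum_pos' (fun i _ => mul_nonneg (hy i).le (hK i))
    ⟨i, Finset.mem_univ _, mul_pos (hy i) (lt_of_le_of_ne (hK i) hi.symm)⟩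

/-- On the zero line of a supporting affine function only vertices on that line contribute. -/
theorem bary_eq_zero_of_pos (K : Tri) {h : Plane →ᵃ[ℝ] ℝ} (hK : ∀ i, 0 ≤ h (K.points i))
    {y : Plane} (hy : y ∈ K.hull) (h0 : h y = 0) {i : Fin 3} (hi : 0 < h (K.points i)) :
    K.bary i y = 0 := by
  rw [K.affine_eq_sum h y, Finset.sum_eq_zero_iff_of_nonneg
    (fun i _ => mul_nonneg ((K.mem_hull_iff y).1 hy i) (hK i))] at h0
  exact (mul_eq_zero.1 (h0 i (Finset.mem_univ i))).resolve_right hi.ne'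

theorem affine_eq_mul_bary (K : Tri) {h : Plane →ᵃ[ℝ] ℝ} {c : Fin 3}
    (hc : ∀ i, i ≠ c → h (K.points i) = 0) (y : Plane) : h y = K.bary c y * h (K.points c) := by
  rw [K.affine_eq_sum h y, Finset.sum_eq_single c (fun j _ hj => by rw [hc j hj, mul_zero])
    (by simp)]

theorem inside_of_hull_subset {K L : Tri} (hs : L.hull ⊆ K.hull) {y : Plane} (hy : L.Inside y) :
    K.Inside y := by
  intro i
  refine L.pos_of_inside (h := K.baryMap i) (v := K.points i) (fun j => ?_) ?_ hy
  · exact (K.mem_hull_iff _).1 (hs (L.points_mem_hull j)) i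
  · rw [baryMap_apply, bary_points]; simp

/-- Near a point in the relative interior of an edge, one side of the line through that edge lies
in the triangle. -/
theorem eventually_mem_hull (K : Tri) {h : Plane →ᵃ[ℝ] ℝ} {c : Fin 3}
    (hc : ∀ i, i ≠ c → h (K.points i) = 0) (hpos : 0 < h (K.points c)) {z : Plane}
    (hz : ∀ i, i ≠ c → 0 < K.bary i z) : ∀ᶠ y in nhds z, 0 ≤ h y → y ∈ K.hull := by
  have h1 : ∀ᶠ y in nhds z, ∀ i, i ≠ c → 0 < K.bary i y := by
    rw [Filter.eventually_all]
    intro i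
    by_cases hi : i = c
    · simp [hi]
    · filter_upwards [(K.continuous_bary i).continuousAt.eventually_const_lt (hz i hi)] with y hy _
      exact hy
  filter_upwards [h1] with y hy h0
  rw [mem_hull_iff]
  intro i
  by_cases hi : i = c
  · subst hi
    rw [K.affine_eq_mul_bary hc] at h0
    exact nonneg_of_mul_nonneg_left h0 hpos
  · exact (hy i hi).le

/-! ### Children and descendants -/

/-- `L` is one of the two triangles into which the bisection splits `K`. -/
def Child (K L : Tri) : Prop := L = K.left ∨ L = K.right

/-- `L` is generated from `K` by successive bisections. -/
def Desc : Tri → Tri → Prop := Relation.ReflTransGen Child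

theorem refMid_eq (K : Tri) : K.refMid = (1 / 2 : ℝ) • K.points 0 + (1 / 2 : ℝ) • K.points 1 := by
  simp only [refMid, midpoint_eq_smul_add, invOf_eq_inv]; module

theorem refMid_mem_hull (K : Tri) : K.refMid ∈ K.hull := by
  rw [refMid_eq]
  exact K.convex_hull (K.points_mem_hull 0) (K.points_mem_hull 1) (by norm_num) (by norm_num)
    (by norm_num)

theorem affine_refMid (K : Tri) (h : Plane →ᵃ[ℝ] ℝ) :
    h K.refMid = (h (K.points 0) + h (K.points 1)) / 2 := by
  have : h K.refMid = midpoint ℝ (h (K.points 0)) (h (K.points 1)) := h.map_midpoint _ _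
  rw [this, midpoint_eq_smul_add, invOf_eq_inv, smul_eq_mul]
  ring

theorem bary_refMid (K : Tri) (i : Fin 3) :
    K.bary i K.refMid = if i = 2 then 0 else 1 / 2 := by
  rw [← baryMap_apply, affine_refMid, baryMap_apply, baryMap_apply, bary_points, bary_points]
  fin_cases i <;> simp

theorem Child.points_cases {K L : Tri} (h : Child K L) (i : Fin 3) :
    L.points i = K.refMid ∨ ∃ j, L.points i = K.points j := by
  rcases h with rfl | rfl <;> fin_cases i <;> simp [left, right]

theorem Child.points_mem {K L : Tri} (h : Child K L) (i : Fin 3) : L.points i ∈ K.hull := by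
  rcases h.points_cases i with h | ⟨j, h⟩ <;> rw [h]
  exacts [K.refMid_mem_hull, K.points_mem_hull j]

theorem Child.hull_subset {K L : Tri} (h : Child K L) : L.hull ⊆ K.hull :=
  convexHull_min (by rintro _ ⟨i, rfl⟩; exact h.points_mem i) K.convex_hull

theorem Desc.hull_subset {K L : Tri} (h : Desc K L) : L.hull ⊆ K.hull := by
  induction h with
  | refl => exact subset_rfl
  | tail _ h ih => exact h.hull_subset.trans ih

theorem hull_eq_union (K : Tri) : K.hull = K.left.hull ∪ K.right.hull := by
  apply subset_antisymm
  · intro y hy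
    have hb := (K.mem_hull_iff y).1 hy
    have hs := K.sum_bary y
    have hsm := K.sum_bary_smul y
    rw [Fin.sum_univ_three] at hs hsm
    rcases le_total (K.bary 1 y) (K.bary 0 y) with hle | hle
    · left
      convert! K.left.sum_smul_mem_hull
        (w := ![K.bary 2 y, K.bary 0 y - K.bary 1 y, 2 * K.bary 1 y]) ?_ ?_ using 1
      · rw [Fin.sum_univ_three]
        simp only [left, Matrix.cons_val, refMid_eq]
        nth_rewrite 1 [← hsm]
        module
      · intro i; fin_cases i
        · exact hb 2
        · exact sub_nonneg.2 hle
        · exact mul_nonneg (by norm_num) (hb 1)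
      · rw [Fin.sum_univ_three]; simp only [Matrix.cons_val]; linarith
    · right
      convert! K.right.sum_smul_mem_hull
        (w := ![K.bary 1 y - K.bary 0 y, K.bary 2 y, 2 * K.bary 0 y]) ?_ ?_ using 1
      · rw [Fin.sum_univ_three]
        simp only [right, Matrix.cons_val, refMid_eq]
        nth_rewrite 1 [← hsm]
        module
      · intro i; fin_cases i
        · exact sub_nonneg.2 hle
        · exact hb 2
        · exact mul_nonneg (by norm_num) (hb 0)
      · rw [Fin.sum_univ_three]; simp only [Matrix.cons_val]; linarith
  · exact Set.union_subset (Child.hull_subset (.inl rfl)) (Child.hull_subset (.inr rfl))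

theorem Desc.generated {T₀ : Set Tri} {K L : Tri} (h : Desc K L) (hK : Generated T₀ K) :
    Generated T₀ L := by
  induction h with
  | refl => exact hK
  | tail _ h ih =>
    rcases h with rfl | rfl
    exacts [.left _ ih, .right _ ih]

/-- A vertex of a descendant of `M` which lies on a supporting line of `M`, and which is not a
vertex of `M`, is the midpoint of a refinement edge on that line. -/
theorem Desc.exists_refMid {M L : Tri} (hd : Desc M L) {h : Plane →ᵃ[ℝ] ℝ}
    (hM : ∀ i, 0 ≤ h (M.points i)) {z : Plane} (hz : z ∈ Set.range L.points)
    (hzM : z ∉ Set.range M.points) (h0 : h z = 0) :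
    ∃ K, Desc M K ∧ K.refMid = z ∧ h (K.points 0) = 0 ∧ h (K.points 1) = 0 := by
  induction hd with
  | refl => exact absurd hz hzM
  | @tail N L hd hc ih =>
    obtain ⟨i, rfl⟩ := hz
    rcases hc.points_cases i with h1 | ⟨j, hj⟩
    · have hN : ∀ j, 0 ≤ h (N.points j) := fun j =>
        M.nonneg_of_mem_hull hM (Desc.hull_subset hd (N.points_mem_hull j))
      rw [h1, affine_refMid] at h0
      have := hN 0
      have := hN 1
      exact ⟨N, hd, h1.symm, by linarith, by linarith⟩
    · exact ih ⟨j, hj.symm⟩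

/-- The midpoint of the refinement edge of a triangle is not an extreme point of any triangle
that contains it. -/
theorem refMid_not_vertex {K M : Tri} (hs : K.hull ⊆ M.hull) : K.refMid ∉ Set.range M.points := by
  rintro ⟨i, hi⟩
  have hz : ∀ j, j ≠ i → ∀ l : Fin 3, l = 0 ∨ l = 1 → M.bary j (K.points l) = 0 := by
    intro j hj l hl
    have h1 : M.baryMap j K.refMid = 0 := by rw [← hi, baryMap_apply, bary_points, if_neg hj]
    rw [affine_refMid, baryMap_apply, baryMap_apply] at h1
    have h2 := (M.mem_hull_iff _).1 (hs (K.points_mem_hull 0)) j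
    have h3 := (M.mem_hull_iff _).1 (hs (K.points_mem_hull 1)) j
    rcases hl with rfl | rfl <;> linarith
  have h0 := M.eq_points_of_bary_eq_zero fun j hj => hz j hj 0 (.inl rfl)
  have h1 := M.eq_points_of_bary_eq_zero fun j hj => hz j hj 1 (.inr rfl)
  exact absurd (K.points_injective (h0.trans h1.symm)) (by decide)

end Tri

/-! ### Conforming meshes -/

theorem affine_eq_zero_of_mem_convexHull {C : Set Plane} {h : Plane →ᵃ[ℝ] ℝ}
    (hC : ∀ y ∈ C, h y = 0) {y : Plane} (hy : y ∈ convexHull ℝ C) : h y = 0 := by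
  have hc : Convex ℝ (h ⁻¹' {0}) := (convex_singleton 0).affine_preimage h
  exact convexHull_min (t := h ⁻¹' {0}) (fun y hy => hC y hy) hc hy

/-- A property which holds near `z` holds at some point of each open segment that starts at `z`. -/
theorem exists_lineMap_of_eventually {z : Plane} {p : Plane → Prop} (hp : ∀ᶠ y in nhds z, p y)
    (y : Plane) : ∃ s : ℝ, 0 < s ∧ s < 1 ∧ p (AffineMap.lineMap z y s) := by
  have htend : Filter.Tendsto (fun s : ℝ => AffineMap.lineMap z y s)
      (nhdsWithin 0 (Set.Ioi 0)) (nhds z) := by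
    have : Continuous fun s : ℝ => AffineMap.lineMap z y s := AffineMap.lineMap_continuous
    have h := this.tendsto 0
    rw [AffineMap.lineMap_apply_zero] at h
    exact h.mono_left nhdsWithin_le_nhds
  have hlt : ∀ᶠ s : ℝ in nhdsWithin 0 (Set.Ioi 0), s < 1 :=
    nhdsWithin_le_nhds (gt_mem_nhds one_pos)
  obtain ⟨s, h1, h2, h3⟩ := ((htend.eventually hp).and (hlt.and self_mem_nhdsWithin)).exists
  exact ⟨s, h3, h2, h1⟩

theorem affine_lineMap (h : Plane →ᵃ[ℝ] ℝ) (x y : Plane) (s : ℝ) :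
    h (AffineMap.lineMap x y s) = s * (h y - h x) + h x := by
  rw [AffineMap.apply_lineMap, AffineMap.lineMap_apply_ring']

theorem Tri.bary_lineMap (K : Tri) (i : Fin 3) (x y : Plane) (s : ℝ) :
    K.bary i (AffineMap.lineMap x y s) = s * (K.bary i y - K.bary i x) + K.bary i x :=
  affine_lineMap (K.baryMap i) x y s

namespace Conforming

variable {T : Set Tri}

/-- Only common vertices contribute to a common point, and the coordinates agree. -/
theorem exists_common (hT : Conforming T) {K L : Tri} (hK : K ∈ T) (hL : L ∈ T) {y : Plane}
    (hyK : y ∈ K.hull) (hyL : y ∈ L.hull) {i : Fin 3} (hi : K.bary i y ≠ 0) :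
    ∃ j, L.points j = K.points i ∧ L.bary j y = K.bary i y := by
  by_cases hKL : K = L
  · subst hKL; exact ⟨i, rfl, rfl⟩
  have hy : y ∈ convexHull ℝ (Set.range K.points ∩ Set.range L.points) := by
    rw [← (hT K hK L hL hKL).2]; exact ⟨hyK, hyL⟩
  have hex : ∃ j, L.points j = K.points i := by
    by_contra! hne
    apply hi
    refine affine_eq_zero_of_mem_convexHull (h := K.baryMap i) ?_ hy
    rintro _ ⟨⟨a, rfl⟩, b, hb⟩
    rw [baryMap_apply, bary_points, if_neg]
    rintro rfl
    exact hne b hb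
  obtain ⟨j, hj⟩ := hex
  refine ⟨j, hj, ?_⟩
  have := affine_eq_zero_of_mem_convexHull (h := L.baryMap j - K.baryMap i) ?_ hy
  · simpa [sub_eq_zero, baryMap_apply] using this
  · rintro _ ⟨⟨a, rfl⟩, b, hb⟩
    rw [AffineMap.coe_sub, Pi.sub_apply, baryMap_apply, baryMap_apply, bary_points, ← hb,
      bary_points, sub_eq_zero]
    congr 1
    rw [← L.points_injective.eq_iff, ← K.points_injective.eq_iff, hb, hj]

theorem eq_of_inside (hT : Conforming T) {K L : Tri} (hK : K ∈ T) (hL : L ∈ T) {y : Plane}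
    (hyK : K.Inside y) (hyL : y ∈ L.hull) : L = K := by
  by_contra hne
  have hsub : Set.range K.points ⊆ Set.range L.points := by
    rintro _ ⟨i, rfl⟩
    obtain ⟨j, hj, -⟩ := hT.exists_common hK hL hyK.mem_hull hyL (hyK i).ne'
    exact ⟨j, hj⟩
  refine (hT K hK L hL (Ne.symm hne)).1 (Set.eq_of_subset_of_ncard_le hsub ?_
    (Set.finite_range _))
  rw [← Set.image_univ, ← Set.image_univ, Set.ncard_image_of_injective _ K.points_injective,
    Set.ncard_image_of_injective _ L.points_injective]

theorem mem_range_of_mem_vertices (hT : Conforming T) {K : Tri} (hK : K ∈ T) {z : Plane}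
    (hz : z ∈ vertices T) (hzK : z ∈ K.hull) : z ∈ Set.range K.points := by
  obtain ⟨L, hL, j, rfl⟩ := hz
  obtain ⟨i, hi, -⟩ := hT.exists_common hL hK (L.points_mem_hull j) hzK (i := j)
    (by rw [bary_points]; simp)
  exact ⟨i, hi⟩

/-- Across the relative interior of an edge, a conforming mesh has triangles on both sides only:
two distinct triangles which share an edge lie on opposite sides of it and cover a neighbourhood of
each point between its end points. -/
theorem edge_neighbor (hT : Conforming T) {K L : Tri} (hK : K ∈ T) (hL : L ∈ T) (hKL : L ≠ K)
    {h : Plane →ᵃ[ℝ] ℝ} {c : Fin 3} (hc : ∀ i, i ≠ c → h (K.points i) = 0)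
    (hpos : 0 < h (K.points c)) {z : Plane} (hzK : z ∈ K.hull) (hzL : z ∈ L.hull)
    (hz : ∀ i, i ≠ c → 0 < K.bary i z) :
    (∀ i, h (L.points i) ≤ 0) ∧ z ∈ interior (meshUnion T) := by
  obtain ⟨i₁, i₂, h12, h1c, h2c⟩ : ∃ i₁ i₂ : Fin 3, i₁ ≠ i₂ ∧ i₁ ≠ c ∧ i₂ ≠ c := by
    clear hc hpos hz; revert c; decide
  obtain ⟨j₁, hj₁, hb₁⟩ := hT.exists_common hK hL hzK hzL (hz i₁ h1c).ne'
  obtain ⟨j₂, hj₂, hb₂⟩ := hT.exists_common hK hL hzK hzL (hz i₂ h2c).ne'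
  have hj12 : j₁ ≠ j₂ := by
    rintro rfl
    exact h12 (K.points_injective (hj₁.symm.trans hj₂))
  obtain ⟨d, hd⟩ : ∃ d : Fin 3, ∀ j, j ≠ d → j = j₁ ∨ j = j₂ := by
    clear hb₁ hb₂ hj₁ hj₂; revert j₁ j₂; decide
  have hd0 : ∀ j, j ≠ d → h (L.points j) = 0 := by
    intro j hj
    rcases hd j hj with rfl | rfl
    · rw [hj₁]; exact hc _ h1c
    · rw [hj₂]; exact hc _ h2c
  have hdz : ∀ j, j ≠ d → 0 < L.bary j z := by
    intro j hj
    rcases hd j hj with rfl | rfl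
    · rw [hb₁]; exact hz _ h1c
    · rw [hb₂]; exact hz _ h2c
  have hdne : h (L.points d) ≠ 0 := by
    intro h0
    have := L.affine_eq_mul_bary hd0 (K.points c)
    rw [h0, mul_zero] at this
    exact hpos.ne' this
  have hz0 : h z = 0 := by
    have h3 : L.bary d z = 0 := by
      by_contra hne
      -- otherwise `z` would be inside `L`, hence in no other triangle
      have hin : L.Inside z := fun j => by
        by_cases hj : j = d
        · subst hj; exact lt_of_le_of_ne ((L.mem_hull_iff z).1 hzL j) (Ne.symm hne)
        · exact hdz j hj
      exact hKL (hT.eq_of_inside hL hK hin hzK).symm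
    rw [L.affine_eq_mul_bary hd0, h3, zero_mul]
  have hKnear := K.eventually_mem_hull hc hpos hz
  have hdneg : h (L.points d) < 0 := by
    rcases lt_or_gt_of_ne hdne with hlt | hgt
    · exact hlt
    -- otherwise both triangles contain a half disc on the same side
    exfalso
    have hLnear := L.eventually_mem_hull hd0 hgt hdz
    obtain ⟨s, hs0, hslt, hs1⟩ := exists_lineMap_of_eventually hLnear (K.points c)
    have hin : K.Inside (AffineMap.lineMap z (K.points c) s) := by
      intro i
      have hbz := (K.mem_hull_iff z).1 hzK i
      rw [bary_lineMap, bary_points]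
      by_cases hic : i = c
      · rw [if_pos hic]; nlinarith
      · rw [if_neg hic]; have := hz i hic; nlinarith
    refine hKL (hT.eq_of_inside hK hL hin (hs1 ?_))
    rw [affine_lineMap, hz0]
    nlinarith
  refine ⟨fun i => ?_, ?_⟩
  · by_cases hi : i = d
    · rw [hi]; exact hdneg.le
    · rw [hd0 i hi]
  · have hLnear := L.eventually_mem_hull (h := -h) (c := d) (z := z)
      (fun j hj => by rw [neg_affine_apply, hd0 j hj, neg_zero])
      (by rw [neg_affine_apply]; linarith) hdz
    rw [mem_interior_iff_mem_nhds]
    filter_upwards [hKnear, hLnear] with y h1 h2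
    rcases le_total 0 (h y) with h0 | h0
    · exact Set.mem_biUnion hK (h1 h0)
    · exact Set.mem_biUnion hL (h2 (by rw [neg_affine_apply]; linarith))

end Conforming

/-! ### Refinements -/

theorem BisectStep.exists_desc {T T' : Set Tri} (h : BisectStep T T') {L : Tri} (hL : L ∈ T') :
    ∃ K ∈ T, Desc K L := by
  obtain ⟨M, hM, rfl⟩ := h
  rcases hL with hL | rfl | rfl
  · exact ⟨L, hL.1, .refl⟩
  · exact ⟨M, hM, .single (.inl rfl)⟩
  · exact ⟨M, hM, .single (.inr rfl)⟩

theorem Refines.exists_desc {T T' : Set Tri} (h : Refines T T') :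
    ∀ {L : Tri}, L ∈ T' → ∃ K ∈ T, Desc K L := by
  induction h with
  | refl => intro L hL; exact ⟨L, hL, .refl⟩
  | tail _ hs ih =>
    intro L hL
    obtain ⟨M, hM, hd⟩ := hs.exists_desc hL
    obtain ⟨K, hK, hd'⟩ := ih hM
    exact ⟨K, hK, hd'.trans hd⟩

theorem Refines.vertices_subset {T T' : Set Tri} (h : Refines T T') :
    vertices T ⊆ vertices T' := by
  induction h with
  | refl => exact subset_rfl
  | tail _ hs ih =>
    refine ih.trans ?_
    obtain ⟨M, hM, rfl⟩ := hs
    rintro z ⟨K, hK, i, rfl⟩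
    by_cases hKM : K = M
    · subst hKM
      fin_cases i
      · exact ⟨_, .inr (.inl rfl), 1, rfl⟩
      · exact ⟨_, .inr (.inr rfl), 0, rfl⟩
      · exact ⟨_, .inr (.inl rfl), 0, rfl⟩
    · exact ⟨K, .inl ⟨hK, hKM⟩, i, rfl⟩

theorem Refines.meshUnion_eq {T T' : Set Tri} (h : Refines T T') :
    meshUnion T' = meshUnion T := by
  induction h with
  | refl => rfl
  | tail _ hs ih =>
    rw [← ih]
    obtain ⟨M, hM, rfl⟩ := hs
    apply subset_antisymm
    · refine Set.iUnion₂_subset fun K hK => ?_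
      rcases hK with hK | rfl | rfl
      · exact Set.subset_biUnion_of_mem (u := Tri.hull) hK.1
      · exact (Child.hull_subset (.inl rfl)).trans (Set.subset_biUnion_of_mem (u := Tri.hull) hM)
      · exact (Child.hull_subset (.inr rfl)).trans (Set.subset_biUnion_of_mem (u := Tri.hull) hM)
    · refine Set.iUnion₂_subset fun K hK => ?_
      by_cases hKM : K = M
      · subst hKM
        rw [K.hull_eq_union]
        exact Set.union_subset (Set.subset_biUnion_of_mem (u := Tri.hull) (.inr (.inl rfl)))
          (Set.subset_biUnion_of_mem (u := Tri.hull) (.inr (.inr rfl)))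
      · exact Set.subset_biUnion_of_mem (u := Tri.hull) (.inl ⟨hK, hKM⟩)

theorem Refines.finite {T T' : Set Tri} (h : Refines T T') (hT : T.Finite) : T'.Finite := by
  induction h with
  | refl => exact hT
  | tail _ hs ih =>
    obtain ⟨M, hM, rfl⟩ := hs
    exact ih.sdiff.union (by simp)

theorem IsTriangulation.of_admissible {Ω : Set Plane} {T₀ T : Set Tri}
    (h : IsTriangulation Ω T₀) (hT : T ∈ admissible T₀) : IsTriangulation Ω T :=
  ⟨hT.1.finite h.1, hT.2, h.2.2.1.trans hT.1.meshUnion_eq.symm, h.2.2.2⟩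

theorem Generated.exists_desc {T₀ : Set Tri} {K : Tri} (h : Generated T₀ K) :
    ∃ M ∈ T₀, Desc M K := by
  induction h with
  | init K hK => exact ⟨K, hK, .refl⟩
  | left K _ ih =>
    obtain ⟨M, hM, hd⟩ := ih
    exact ⟨M, hM, hd.tail (.inl rfl)⟩
  | right K _ ih =>
    obtain ⟨M, hM, hd⟩ := ih
    exact ⟨M, hM, hd.tail (.inr rfl)⟩

theorem Refines.generated {T₀ T : Set Tri} (h : Refines T₀ T) {K : Tri} (hK : K ∈ T) :
    Generated T₀ K := by
  obtain ⟨M, hM, hd⟩ := h.exists_desc hK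
  exact Desc.generated hd (.init M hM)

/-- A generated triangle is either part of a triangle of the mesh or a union of triangles of the
mesh. -/
theorem Refines.desc_or_covered {T₀ T : Set Tri} (h : Refines T₀ T) {K : Tri}
    (hK : Generated T₀ K) :
    (∃ M ∈ T, Desc M K) ∨ ∀ y ∈ K.hull, ∃ L ∈ T, Desc K L ∧ y ∈ L.hull := by
  induction h with
  | refl => exact .inl hK.exists_desc
  | tail _ hs ih =>
    obtain ⟨N, hN, rfl⟩ := hs
    have hsplit : ∀ y ∈ N.hull, ∃ L, (L = N.left ∨ L = N.right) ∧ y ∈ L.hull := by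
      intro y hy
      rw [N.hull_eq_union] at hy
      rcases hy with hy | hy
      exacts [⟨_, .inl rfl, hy⟩, ⟨_, .inr rfl, hy⟩]
    rcases ih with ⟨M, hM, hd⟩ | hcov
    · by_cases hMN : M = N
      · subst hMN
        rcases hd.cases_head with rfl | ⟨L, hL, hd⟩
        · right
          intro y hy
          obtain ⟨L, hL, hyL⟩ := hsplit y hy
          exact ⟨L, .inr (by simpa using hL), .single hL, hyL⟩
        · exact .inl ⟨L, .inr (by simpa [Child] using hL), hd⟩
      · exact .inl ⟨M, .inl ⟨hM, hMN⟩, hd⟩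
    · right
      intro y hy
      obtain ⟨L, hL, hd, hyL⟩ := hcov y hy
      by_cases hLN : L = N
      · subst hLN
        obtain ⟨L', hL', hyL'⟩ := hsplit y hyL
        exact ⟨L', .inr (by simpa using hL'), hd.tail hL', hyL'⟩
      · exact ⟨L, .inl ⟨hL, hLN⟩, hd, hyL⟩

/-- If a vertex `x` of an admissible mesh is the midpoint of the refinement edge of a generated
triangle `K`, then the line through that edge does not cross the triangles at `x`. -/
theorem one_sided_of_mem {T₀ T : Set Tri} (hT : T ∈ admissible T₀) {K : Tri}
    (hK : Generated T₀ K) (hx : K.refMid ∈ vertices T) {N : Tri} (hN : N ∈ T)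
    (hxN : K.refMid ∈ N.hull) :
    (∀ i, 0 ≤ K.bary 2 (N.points i)) ∨ ∀ i, K.bary 2 (N.points i) ≤ 0 := by
  rcases hT.1.desc_or_covered hK with ⟨M, hM, hd⟩ | hcov
  · exact absurd (hT.2.mem_range_of_mem_vertices hM hx (Desc.hull_subset hd K.refMid_mem_hull))
      (refMid_not_vertex (Desc.hull_subset hd))
  by_cases hd : Desc K N
  · exact .inl fun i => (K.mem_hull_iff _).1 (Desc.hull_subset hd (N.points_mem_hull i)) 2
  right
  by_contra! hcon
  obtain ⟨v, hv⟩ := hcon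
  -- a point inside `N` and strictly on the side of `K`
  obtain ⟨δ, hδ0, hδ1, hδ⟩ := exists_lineMap_of_eventually
    ((K.continuous_bary 2).continuousAt.eventually_const_lt hv) N.mid
  set y := AffineMap.lineMap (N.points v) N.mid δ with hy
  have hyin : N.Inside y := by
    intro i
    have hm := N.inside_mid i
    rw [hy, bary_lineMap, bary_points]
    split_ifs <;> nlinarith
  have hnear := K.eventually_mem_hull (h := K.baryMap 2) (c := 2) (z := K.refMid)
    (fun i hi => by rw [baryMap_apply, bary_points, if_neg (Ne.symm hi)])
    (by rw [baryMap_apply, bary_points]; simp)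
    (fun i hi => by rw [bary_refMid, if_neg hi]; norm_num)
  obtain ⟨s, hs0, hslt, hs1⟩ := exists_lineMap_of_eventually hnear y
  have hsin : N.Inside (AffineMap.lineMap K.refMid y s) := by
    intro i
    have hm := hyin i
    have hx0 := (N.mem_hull_iff _).1 hxN i
    rw [bary_lineMap]
    nlinarith
  obtain ⟨L, hL, hdL, hyL⟩ := hcov _ (hs1 (by
    rw [baryMap_apply, bary_lineMap, bary_refMid, if_pos rfl]
    nlinarith))
  rw [hT.2.eq_of_inside hN hL hsin hyL] at hdL
  exact hd hdL

/-! ### Gluing Lipschitz functions -/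

theorem dist_le_of_closed_cover {E : Type*} [PseudoMetricSpace E] {g : ℝ → E} {C : ℝ}
    (F : Finset (Set ℝ)) : ∀ {a b : ℝ}, a ≤ b → (∀ A ∈ F, IsClosed A) →
    (∀ A ∈ F, ∀ x ∈ A, ∀ y ∈ A, dist (g x) (g y) ≤ C * |x - y|) →
    (Set.Icc a b ⊆ ⋃ A ∈ F, A) → dist (g a) (g b) ≤ C * (b - a) := by
  classical
  induction F using Finset.strongInduction with
  | H F ih =>
  intro a b hab hcl hL hcov
  obtain ⟨A, hA, haA⟩ := Set.mem_iUnion₂.1 (hcov (Set.left_mem_Icc.2 hab))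
  -- the last point of the segment in a set which contains the first point
  set c := sSup (A ∩ Set.Icc a b) with hc
  have hcA : c ∈ A ∩ Set.Icc a b :=
    ((isCompact_Icc.inter_left (hcl A hA)).isClosed).csSup_mem ⟨a, haA, Set.left_mem_Icc.2 hab⟩
      (bddAbove_Icc.mono Set.inter_subset_right)
  have hac : dist (g a) (g c) ≤ C * (c - a) := by
    have := hL A hA a haA c hcA.1
    rwa [abs_sub_comm, abs_of_nonneg (sub_nonneg.2 hcA.2.1)] at this
  rcases eq_or_lt_of_le hcA.2.2 with hcb | hcb
  · rwa [hcb] at hac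
  have hcov' : Set.Icc c b ⊆ ⋃ B ∈ F.erase A, B := by
    rw [← closure_Ioc hcb.ne]
    refine closure_minimal (fun y hy => ?_) ?_
    · obtain ⟨B, hB, hyB⟩ := Set.mem_iUnion₂.1 (hcov ⟨hcA.2.1.trans hy.1.le, hy.2⟩)
      refine Set.mem_iUnion₂.2 ⟨B, Finset.mem_erase.2 ⟨?_, hB⟩, hyB⟩
      rintro rfl
      exact absurd (le_csSup (bddAbove_Icc.mono Set.inter_subset_right)
        ⟨hyB, hcA.2.1.trans hy.1.le, hy.2⟩) (not_le.2 hy.1)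
    · exact isClosed_biUnion_finset fun B hB => hcl B (Finset.mem_of_mem_erase hB)
  have hcb' := ih _ (Finset.erase_ssubset hA) hcb.le
    (fun B hB => hcl B (Finset.mem_of_mem_erase hB))
    (fun B hB => hL B (Finset.mem_of_mem_erase hB)) hcov'
  calc dist (g a) (g b) ≤ dist (g a) (g c) + dist (g c) (g b) := dist_triangle _ _ _
    _ ≤ C * (c - a) + C * (b - c) := add_le_add hac hcb'
    _ = C * (b - a) := by ring

/-- A function that is Lipschitz on each of finitely many closed sets which cover the space is
Lipschitz: along a segment the increments add up. -/
theorem exists_lipschitzWith_of_closed_cover {E : Type*} [NormedAddCommGroup E] [NormedSpace ℝ E]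
    {w : E → ℝ} {F : Set (Set E)} (hF : F.Finite) (hcl : ∀ A ∈ F, IsClosed A)
    (hL : ∀ A ∈ F, ∃ C, LipschitzOnWith C w A) (hcov : ∀ y, ∃ A ∈ F, y ∈ A) :
    ∃ C, LipschitzWith C w := by
  classical
  choose! C hC using hL
  obtain ⟨D, hD⟩ := (hF.image C).bddAbove
  refine ⟨D, LipschitzWith.of_dist_le_mul fun x y => ?_⟩
  have hl : Continuous fun s : ℝ => AffineMap.lineMap x y s := AffineMap.lineMap_continuous
  have := dist_le_of_closed_cover (g := fun s => w (AffineMap.lineMap x y s))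
    (C := D * dist x y) ((hF.image fun A => (fun s : ℝ => AffineMap.lineMap x y s) ⁻¹' A).toFinset)
    zero_le_one (fun B hB => ?_) (fun B hB s hs t ht => ?_) (fun s _ => ?_)
  · simpa using this
  · rw [Set.Finite.mem_toFinset] at hB
    obtain ⟨A, hA, rfl⟩ := hB
    exact (hcl A hA).preimage hl
  · rw [Set.Finite.mem_toFinset] at hB
    obtain ⟨A, hA, rfl⟩ := hB
    have h1 := (hC A hA).dist_le_mul _ hs _ ht
    rw [dist_lineMap_lineMap, Real.dist_eq s t] at h1
    have h2 : (C A : ℝ) ≤ D := hD ⟨A, hA, rfl⟩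
    have h3 : 0 ≤ |s - t| * dist x y := mul_nonneg (abs_nonneg _) dist_nonneg
    nlinarith
  · obtain ⟨A, hA, hs⟩ := hcov (AffineMap.lineMap x y s)
    exact Set.mem_iUnion₂.2 ⟨_, (Set.Finite.mem_toFinset _).2 ⟨A, hA, rfl⟩, hs⟩

theorem integral_lineDeriv_eq_zero {w : Plane → ℝ} {C : NNReal} (hw : LipschitzWith C w)
    (hc : HasCompactSupport w) (v : Plane) : ∫ y, lineDeriv ℝ w y v = 0 := by
  have := LipschitzWith.integral_lineDeriv_mul_eq (μ := volume)
    (LipschitzWith.const (1 : ℝ)) hw hc (-v)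
  simpa [lineDeriv] using this.symm

/-! ### Almost every point is inside a triangle of the mesh -/

theorem volume_affine_zero {h : Plane →ᵃ[ℝ] ℝ} {v : Plane} (hv : h v ≠ 0) :
    volume {y | h y = 0} = 0 := by
  have hne : (AffineSubspace.comap h (AffineSubspace.mk' 0 ⊥)) ≠ ⊤ := by
    intro ht
    have : v ∈ AffineSubspace.comap h (AffineSubspace.mk' (0 : ℝ) ⊥) := by rw [ht]; trivial
    rw [AffineSubspace.mem_comap, AffineSubspace.mem_mk'] at this
    exact hv (by simpa using this)
  have := Measure.addHaar_affineSubspace volume _ hne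
  convert this using 2
  ext y
  simp [AffineSubspace.mem_mk']

theorem Tri.ae_inside (K : Tri) : ∀ᵐ y, y ∈ K.hull → K.Inside y := by
  have : ∀ i, ∀ᵐ y, K.bary i y ≠ 0 := fun i => by
    rw [ae_iff]
    convert volume_affine_zero (h := K.baryMap i) (v := K.points i) ?_ using 2
    · ext y; simp [baryMap_apply]
    · rw [baryMap_apply, bary_points]; simp
  filter_upwards [ae_all_iff.2 this] with y hy hyK i
  exact lt_of_le_of_ne ((K.mem_hull_iff y).1 hyK i) (hy i).symm

theorem Tri.ae_restrict_inside (K : Tri) : ∀ᵐ y ∂volume.restrict K.hull, K.Inside y :=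
  (ae_restrict_iff' K.isClosed_hull.measurableSet).2 K.ae_inside

namespace IsTriangulation

variable {Ω : Set Plane} {T : Set Tri}

theorem isOpen (h : IsTriangulation Ω T) : IsOpen Ω := h.2.2.2 ▸ isOpen_interior

theorem subset_meshUnion (h : IsTriangulation Ω T) : Ω ⊆ meshUnion T :=
  h.2.2.1 ▸ subset_closure

theorem interior_meshUnion (h : IsTriangulation Ω T) : interior (meshUnion T) = Ω := by
  rw [← h.2.2.1, h.2.2.2]

theorem ae_inside (h : IsTriangulation Ω T) :
    ∀ᵐ y ∂volume, y ∈ meshUnion T → ∃ K ∈ T, K.Inside y := by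
  have h1 : ∀ᵐ y ∂volume, ∀ K ∈ T, y ∈ K.hull → K.Inside y :=
    (ae_ball_iff h.1.countable).2 fun K _ => K.ae_inside
  filter_upwards [h1] with y hy hyT
  obtain ⟨K, hK, hyK⟩ := Set.mem_iUnion₂.1 hyT
  exact ⟨K, hK, hy K hK hyK⟩

theorem ae_restrict_inside (h : IsTriangulation Ω T) :
    ∀ᵐ y ∂volume.restrict Ω, ∃ K ∈ T, K.Inside y := by
  rw [ae_restrict_iff' h.isOpen.measurableSet]
  filter_upwards [h.ae_inside] with y hy hyΩ
  exact hy (h.subset_meshUnion hyΩ)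

/-- To compare two functions on `Ω` it suffices to compare them inside the triangles. -/
theorem ae_eq_of_inside {β : Type*} (h : IsTriangulation Ω T) {u v : Plane → β}
    (huv : ∀ K ∈ T, ∀ y, K.Inside y → u y = v y) : u =ᵐ[volume.restrict Ω] v := by
  filter_upwards [h.ae_restrict_inside] with y ⟨K, hK, hy⟩
  exact huv K hK y hy

theorem sum_indicator_eq {β : Type*} [AddCommMonoid β] (h : IsTriangulation Ω T)
    (g : Tri → Plane → β) {K : Tri} (hK : K ∈ T) {y : Plane} (hy : K.Inside y) :
    ∑ L ∈ h.1.toFinset, L.hull.indicator (g L) y = g K y := by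
  rw [Finset.sum_eq_single K, Set.indicator_of_mem hy.mem_hull]
  · intro L hL hLK
    refine Set.indicator_of_notMem (fun hyL => hLK ?_) _
    exact h.2.1.eq_of_inside hK (h.1.mem_toFinset.1 hL) hy hyL
  · intro hK'
    exact absurd (h.1.mem_toFinset.2 hK) hK'

end IsTriangulation

/-! ### Square integrability -/

theorem Tri.memL2_indicator (K : Tri) (Ω : Set Plane) {g : Plane → ℝ} (hg : Continuous g) :
    MemL2 Ω (K.hull.indicator g) := by
  obtain ⟨C, hC⟩ := K.isCompact_hull.exists_bound_of_continuousOn hg.continuousOn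
  have h1 : MemLp g 2 (volume.restrict K.hull) := by
    have : IsFiniteMeasure (volume.restrict K.hull) :=
      ⟨by simpa using K.isCompact_hull.measure_lt_top⟩
    refine MemLp.of_bound hg.aestronglyMeasurable C ?_
    rw [ae_restrict_iff' K.isClosed_hull.measurableSet]
    exact .of_forall hC
  exact ((memLp_indicator_iff_restrict K.isClosed_hull.measurableSet).2 h1).restrict Ω

theorem IsTriangulation.memL2 {Ω : Set Plane} {T : Set Tri} (h : IsTriangulation Ω T)
    {u : Plane → ℝ} {g : Tri → Plane → ℝ} (hg : ∀ K ∈ T, Continuous (g K))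
    (hu : ∀ K ∈ T, ∀ y, K.Inside y → u y = g K y) : MemL2 Ω u := by
  have h1 : MemLp (fun y => ∑ K ∈ h.1.toFinset, K.hull.indicator (g K) y) 2
      (volume.restrict Ω) :=
    memLp_finsetSum _ fun K hK => K.memL2_indicator Ω (hg K (h.1.mem_toFinset.1 hK))
  refine h1.ae_eq (h.ae_eq_of_inside fun K hK y hy => ?_)
  rw [h.sum_indicator_eq g hK hy, hu K hK y hy]

theorem MemL2.integrable_mul {Ω : Set Plane} {u ψ : Plane → ℝ} (hu : MemL2 Ω u)
    (hψ : Continuous ψ) (hc : HasCompactSupport ψ) :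
    Integrable (fun y => u y * ψ y) (volume.restrict Ω) :=
  MemLp.integrable_mul (p := 2) (q := 2) hu (hψ.memLp_of_hasCompactSupport hc)

namespace IsTest

variable {Ω : Set Plane} {φ : Plane → ℝ}

theorem eq_zero (h : IsTest Ω φ) {y : Plane} (hy : y ∉ Ω) : φ y = 0 :=
  image_eq_zero_of_notMem_tsupport fun h' => hy (h.2.2 h')

theorem fderiv_eq_zero (h : IsTest Ω φ) {y : Plane} (hy : y ∉ Ω) : fderiv ℝ φ y = 0 :=
  image_eq_zero_of_notMem_tsupport fun h' => hy (h.2.2 (tsupport_fderiv_subset ℝ h'))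

theorem differentiable (h : IsTest Ω φ) : Differentiable ℝ φ := h.1.differentiable (by simp)

theorem continuous_fderiv_apply (h : IsTest Ω φ) (v : Plane) :
    Continuous fun y => fderiv ℝ φ y v :=
  (h.1.continuous_fderiv (by simp)).clm_apply continuous_const

theorem hasCompactSupport_fderiv_apply (h : IsTest Ω φ) (v : Plane) :
    HasCompactSupport fun y => fderiv ℝ φ y v :=
  h.2.1.fderiv_apply ℝ v

theorem continuous_partialDeriv (h : IsTest Ω φ) (j : Fin 2) : Continuous (partialDeriv j φ) :=
  h.continuous_fderiv_apply _

theorem hasCompactSupport_partialDeriv (h : IsTest Ω φ) (j : Fin 2) :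
    HasCompactSupport (partialDeriv j φ) :=
  h.hasCompactSupport_fderiv_apply _

theorem sum_partialDeriv (φ : Plane → ℝ) (t y : Plane) :
    ∑ j, t j * partialDeriv j φ y = fderiv ℝ φ y t := by
  have : t = ∑ j, t j • EuclideanSpace.single j (1 : ℝ) := by
    ext i; fin_cases i <;> simp
  conv_rhs => rw [this]
  simp [partialDeriv]

end IsTest

/-! ### Continuous piecewise smooth functions are in `H¹` -/

theorem IsTriangulation.memH1 {Ω : Set Plane} {T : Set Tri} (h : IsTriangulation Ω T)
    {u : Plane → ℝ} {g : Tri → Plane → ℝ} (hg : ∀ K ∈ T, ContDiff ℝ ∞ (g K))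
    (hu : ∀ K ∈ T, ∀ y ∈ K.hull, u y = g K y) : MemH1 Ω u := by
  refine ⟨h.memL2 (fun K hK => (hg K hK).continuous) fun K hK y hy => hu K hK y hy.mem_hull,
    fun j => ?_⟩
  set e : Plane := EuclideanSpace.single j 1
  set d : Plane → ℝ := fun y => ∑ K ∈ h.1.toFinset, K.hull.indicator (fun y => fderiv ℝ (g K) y e) y
  have hd : ∀ K ∈ T, ∀ y, K.Inside y → d y = fderiv ℝ (g K) y e := fun K hK y hy =>
    h.sum_indicator_eq (fun K y => fderiv ℝ (g K) y e) hK hy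
  have hd2 : MemL2 Ω d := h.memL2 (fun K hK =>
    ((hg K hK).continuous_fderiv (by simp)).clm_apply continuous_const) hd
  refine ⟨d, hd2, fun φ hφ => ?_⟩
  -- the product with a test function is Lipschitz on the whole plane
  obtain ⟨C, hC⟩ : ∃ C, LipschitzWith C fun y => u y * φ y := by
    refine exists_lipschitzWith_of_closed_cover (F := insert Ωᶜ (Tri.hull '' T))
      ((h.1.image _).insert _) ?_ ?_ ?_
    · rintro A (rfl | ⟨K, hK, rfl⟩)
      exacts [h.isOpen.isClosed_compl, K.isClosed_hull]
    · rintro A (rfl | ⟨K, hK, rfl⟩)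
      · refine ⟨0, LipschitzOnWith.of_dist_le_mul fun x hx y hy => ?_⟩
        simp [hφ.eq_zero hx, hφ.eq_zero hy]
      · obtain ⟨C, hC⟩ := ContDiff.lipschitzWith_of_hasCompactSupport (𝕂 := ℝ) (n := ∞)
          (f := fun y => g K y * φ y) (hφ.2.1.mul_left) ((hg K hK).mul hφ.1) (by simp)
        refine ⟨C, LipschitzOnWith.of_dist_le_mul fun x hx y hy => ?_⟩
        rw [hu K hK x hx, hu K hK y hy]
        exact hC.dist_le_mul x y
    · intro y
      by_cases hy : y ∈ Ω
      · obtain ⟨K, hK, hyK⟩ := Set.mem_iUnion₂.1 (h.subset_meshUnion hy)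
        exact ⟨_, .inr ⟨K, hK, rfl⟩, hyK⟩
      · exact ⟨_, .inl rfl, hy⟩
  have h0 := integral_lineDeriv_eq_zero hC hφ.2.1.mul_left e
  have hae : (fun y => lineDeriv ℝ (fun y => u y * φ y) y e) =ᵐ[volume]
      fun y => u y * partialDeriv j φ y + d y * φ y := by
    filter_upwards [h.ae_inside] with y hy
    by_cases hyT : y ∈ meshUnion T
    · obtain ⟨K, hK, hyK⟩ := hy hyT
      have hev : (fun y => u y * φ y) =ᶠ[nhds y] fun y => g K y * φ y := by
        filter_upwards [K.isOpen_inside.mem_nhds hyK] with y hy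
        rw [hu K hK y hy.mem_hull]
      have hgd : DifferentiableAt ℝ (g K) y := (hg K hK).differentiable (by simp) y
      rw [hev.lineDeriv_eq, (hgd.fun_mul (hφ.differentiable y)).lineDeriv_eq_fderiv,
        fderiv_fun_mul hgd (hφ.differentiable y), hd K hK y hyK, hu K hK y hyK.mem_hull]
      simp only [partialDeriv, add_apply, smul_apply,
        smul_eq_mul]
      ring
    · have hcl : IsClosed (meshUnion T) := h.2.2.1 ▸ isClosed_closure
      have hev : (fun y => u y * φ y) =ᶠ[nhds y] fun _ => 0 := by
        filter_upwards [hcl.isOpen_compl.mem_nhds hyT] with y hy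
        rw [hφ.eq_zero fun h' => hy (h.subset_meshUnion h'), mul_zero]
      have hyΩ : y ∉ Ω := fun h' => hyT (h.subset_meshUnion h')
      rw [hev.lineDeriv_eq]
      simp [lineDeriv, partialDeriv, hφ.eq_zero hyΩ, hφ.fderiv_eq_zero hyΩ]
  rw [integral_congr_ae hae, ← setIntegral_eq_integral_of_forall_compl_eq_zero (s := Ω)
    (fun y hy => by simp [partialDeriv, hφ.eq_zero hy, hφ.fderiv_eq_zero hy]),
    integral_add] at h0
  · linarith
  · exact (h.memL2 (fun K hK => (hg K hK).continuous)
      fun K hK y hy => hu K hK y hy.mem_hull).integrable_mul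
      (hφ.continuous_fderiv_apply e) (hφ.hasCompactSupport_fderiv_apply e)
  · exact hd2.integrable_mul hφ.1.continuous hφ.2.1

/-! ### Affine functions and polynomials -/

theorem contDiff_evalAt (p : Poly) : ContDiff ℝ ∞ fun y => evalAt y p := by
  unfold evalAt
  induction p using MvPolynomial.induction_on with
  | C a => simpa using contDiff_const
  | add p q hp hq => simpa using hp.add hq
  | mul_X p i hp => simpa using hp.mul (by fun_prop : ContDiff ℝ ∞ fun y : Plane => y i)

theorem exists_poly_of_affine (h : Plane →ᵃ[ℝ] ℝ) :
    ∃ p : Poly, p.totalDegree ≤ 1 ∧ ∀ y, evalAt y p = h y := by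
  refine ⟨MvPolynomial.C (h 0) + ∑ i, MvPolynomial.C (h.linear (EuclideanSpace.single i 1)) *
    MvPolynomial.X i, ?_, fun y => ?_⟩
  · refine (MvPolynomial.totalDegree_add _ _).trans (max_le (by simp) ?_)
    refine MvPolynomial.totalDegree_finsetSum_le fun i _ => ?_
    exact (MvPolynomial.totalDegree_mul _ _).trans (by simp)
  · have hy : y = ∑ i, y i • EuclideanSpace.single i (1 : ℝ) := by
      ext i; fin_cases i <;> simp
    have h1 : h y = h.linear y + h 0 := by
      have := h.map_vadd 0 y
      simpa using this
    rw [h1]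
    nth_rewrite 2 [hy]
    simp [evalAt]
    ring

/-- The barycentric coordinate as a polynomial. -/
noncomputable def Tri.baryPoly (K : Tri) (i : Fin 3) : Poly :=
  (exists_poly_of_affine (K.baryMap i)).choose

theorem Tri.totalDegree_baryPoly (K : Tri) (i : Fin 3) : (K.baryPoly i).totalDegree ≤ 1 :=
  (exists_poly_of_affine (K.baryMap i)).choose_spec.1

theorem Tri.evalAt_baryPoly (K : Tri) (i : Fin 3) (y : Plane) :
    evalAt y (K.baryPoly i) = K.bary i y :=
  (exists_poly_of_affine (K.baryMap i)).choose_spec.2 y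

theorem Tri.contDiff_bary (K : Tri) (i : Fin 3) : ContDiff ℝ ∞ (K.bary i) := by
  simpa only [K.evalAt_baryPoly] using contDiff_evalAt (K.baryPoly i)

theorem affine_add_smul (h : Plane →ᵃ[ℝ] ℝ) (y t : Plane) (s : ℝ) :
    h (y + s • t) = h y + s * h.linear t := by
  have := h.map_vadd y (s • t)
  rw [vadd_eq_add, vadd_eq_add, map_smul, smul_eq_mul] at this
  rw [add_comm y, this, add_comm]

theorem affine_linear_sub (h : Plane →ᵃ[ℝ] ℝ) (x y : Plane) : h.linear (x - y) = h x - h y :=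
  h.linearMap_vsub x y

/-! ### Tangential bubbles have a square integrable divergence -/

theorem Tri.exists_lipschitzWith_indicator (K : Tri) {w : Plane → ℝ} (hw : ContDiff ℝ ∞ w)
    (hc : HasCompactSupport w) (h0 : ∀ y ∈ K.hull, ∀ i, K.bary i y = 0 → w y = 0) :
    ∃ C, LipschitzWith C (K.hull.indicator w) := by
  refine exists_lipschitzWith_of_closed_cover
    (F := {K.hull, ⋃ i, {y | K.bary i y ≤ 0}}) (by simp) ?_ ?_ ?_
  · rintro A (rfl | rfl)
    · exact K.isClosed_hull
    · exact isClosed_iUnion_of_finite fun i => isClosed_le (K.continuous_bary i) continuous_const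
  · rintro A (rfl | rfl)
    · obtain ⟨C, hC⟩ := ContDiff.lipschitzWith_of_hasCompactSupport (𝕂 := ℝ) (n := ∞) hc hw
        (by simp)
      refine ⟨C, LipschitzOnWith.of_dist_le_mul fun x hx y hy => ?_⟩
      rw [Set.indicator_of_mem hx, Set.indicator_of_mem hy]
      exact hC.dist_le_mul x y
    · have hz : ∀ y ∈ ⋃ i, {y | K.bary i y ≤ 0}, K.hull.indicator w y = 0 := by
        intro y hy
        obtain ⟨i, hi⟩ := Set.mem_iUnion.1 hy
        by_cases hyK : y ∈ K.hull
        · rw [Set.indicator_of_mem hyK]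
          exact h0 y hyK i (le_antisymm hi ((K.mem_hull_iff y).1 hyK i))
        · rw [Set.indicator_of_notMem hyK]
      refine ⟨0, LipschitzOnWith.of_dist_le_mul fun x hx y hy => ?_⟩
      simp [hz x hx, hz y hy]
  · intro y
    by_cases hy : y ∈ K.hull
    · exact ⟨_, .inl rfl, hy⟩
    · rw [mem_hull_iff] at hy
      push Not at hy
      obtain ⟨i, hi⟩ := hy
      exact ⟨_, .inr rfl, Set.mem_iUnion.2 ⟨i, hi.le⟩⟩

/-- Integration by parts in the direction `t` of an edge, for a function that vanishes on the two
other edges. The cut-off `1 - (1 - λ_c) ^ m` is constant in the direction `t` and removes the jump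
across the edge; it tends to one inside the triangle. -/
theorem Tri.integral_fderiv_eq_zero (K : Tri) {c : Fin 3} {F : Plane → ℝ}
    (hF : ContDiff ℝ ∞ F) (hFc : HasCompactSupport F)
    (h0 : ∀ y ∈ K.hull, ∀ i, i ≠ c → K.bary i y = 0 → F y = 0) {t : Plane}
    (ht : (K.baryMap c).linear t = 0) :
    ∫ y, K.hull.indicator (fun y => fderiv ℝ F y t) y = 0 := by
  set χ : ℕ → Plane → ℝ := fun m y => 1 - (1 - K.bary c y) ^ m with hχ
  have hFd : Continuous fun y => fderiv ℝ F y t :=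
    (hF.continuous_fderiv (by simp)).clm_apply continuous_const
  have hb1 : ∀ y ∈ K.hull, 0 ≤ K.bary c y ∧ K.bary c y ≤ 1 := fun y hy =>
    ⟨(K.mem_hull_iff y).1 hy c, (K.sum_bary y) ▸ Finset.single_le_sum
      (f := fun i => K.bary i y) (fun i _ => (K.mem_hull_iff y).1 hy i) (Finset.mem_univ c)⟩
  have hint : ∀ m, 1 ≤ m →
      ∫ y, K.hull.indicator (fun y => χ m y * fderiv ℝ F y t) y = 0 := by
    intro m hm
    have hχc : ContDiff ℝ ∞ (χ m) :=
      contDiff_const.sub ((contDiff_const.sub (K.contDiff_bary c)).pow m)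
    have hsupp : HasCompactSupport fun y => F y * χ m y := hFc.mul_right
    obtain ⟨C, hC⟩ := K.exists_lipschitzWith_indicator (hF.mul hχc) hsupp (by
      intro y hy i hi
      by_cases hic : i = c
      · subst hic
        simp [hχ, hi]
      · simp [h0 y hy i hic hi])
    have hsupp' : HasCompactSupport (K.hull.indicator fun y => F y * χ m y) :=
      HasCompactSupport.intro K.isCompact_hull fun y hy => Set.indicator_of_notMem hy _
    rw [← integral_lineDeriv_eq_zero hC hsupp' t]
    refine integral_congr_ae ?_
    filter_upwards [K.ae_inside] with y hy
    by_cases hyK : y ∈ K.hull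
    · have hev : (K.hull.indicator fun y => F y * χ m y) =ᶠ[nhds y] fun y => F y * χ m y := by
        filter_upwards [K.isOpen_inside.mem_nhds (hy hyK)] with z hz
        rw [Set.indicator_of_mem hz.mem_hull]
      rw [hev.lineDeriv_eq, Set.indicator_of_mem hyK]
      have hχt : ∀ s : ℝ, χ m (y + s • t) = χ m y := fun s => by
        have := affine_add_smul (K.baryMap c) y t s
        rw [ht, mul_zero, add_zero] at this
        simp only [hχ, ← baryMap_apply, this]
      have hl := (hF.differentiable (by simp) y).hasFDerivAt.hasLineDerivAt t
      unfold HasLineDerivAt at hl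
      simp only [lineDeriv, hχt]
      rw [(hl.mul_const (χ m y)).deriv, mul_comm]
    · have hev : (K.hull.indicator fun y => F y * χ m y) =ᶠ[nhds y] fun _ => 0 := by
        filter_upwards [K.isClosed_hull.isOpen_compl.mem_nhds hyK] with z hz
        rw [Set.indicator_of_notMem hz]
      rw [hev.lineDeriv_eq, Set.indicator_of_notMem hyK]
      simp [lineDeriv]
  have hcont : ∀ m, Continuous fun y => χ m y * fderiv ℝ F y t := fun m =>
    (continuous_const.sub ((continuous_const.sub (K.continuous_bary c)).pow m)).mul hFd
  have hlim := tendsto_integral_of_dominated_convergence (μ := volume)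
    (F := fun m y => K.hull.indicator (fun y => χ m y * fderiv ℝ F y t) y)
    (f := K.hull.indicator (fun y => fderiv ℝ F y t))
    (K.hull.indicator fun y => ‖fderiv ℝ F y t‖)
    (fun m => (hcont m).aestronglyMeasurable.indicator K.isClosed_hull.measurableSet)
    ((integrable_indicator_iff K.isClosed_hull.measurableSet).2
      (hFd.norm.continuousOn.integrableOn_compact K.isCompact_hull))
    (fun m => .of_forall fun y => ?_) ?_
  · refine tendsto_nhds_unique hlim (tendsto_const_nhds.congr' ?_)
    filter_upwards [Filter.eventually_ge_atTop 1] with m hm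
    rw [hint m hm]
  · rw [norm_indicator_eq_indicator_norm]
    refine Set.indicator_le_indicator' fun hy => ?_
    obtain ⟨h1, h2⟩ := hb1 y hy
    rw [norm_mul]
    refine mul_le_of_le_one_left (norm_nonneg _) ?_
    have h3 : 0 ≤ (1 - K.bary c y) ^ m := pow_nonneg (by linarith) m
    have h4 : (1 - K.bary c y) ^ m ≤ 1 := pow_le_one₀ (by linarith) (by linarith)
    rw [Real.norm_eq_abs, abs_le]
    constructor <;> simp only [hχ] <;> linarith
  · filter_upwards [K.ae_inside] with y hy
    by_cases hyK : y ∈ K.hull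
    · simp only [Set.indicator_of_mem hyK, hχ]
      have h1 := tendsto_pow_atTop_nhds_zero_of_lt_one (r := 1 - K.bary c y)
        (by linarith [(hb1 y hyK).2]) (by linarith [hy hyK c])
      simpa using (tendsto_const_nhds (x := (1 : ℝ))).sub h1 |>.mul_const (fderiv ℝ F y t)
    · simp only [Set.indicator_of_notMem hyK]
      exact tendsto_const_nhds

theorem Tri.integral_bubble (K : Tri) {c : Fin 3} {G : Plane → ℝ} (hG : ContDiff ℝ ∞ G)
    (h0 : ∀ y ∈ K.hull, ∀ i, i ≠ c → K.bary i y = 0 → G y = 0) {t : Plane}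
    (ht : (K.baryMap c).linear t = 0) {Ω : Set Plane} {φ : Plane → ℝ} (hφ : IsTest Ω φ) :
    ∫ y in Ω, K.hull.indicator G y * fderiv ℝ φ y t =
      -∫ y in Ω, K.hull.indicator (fun y => fderiv ℝ G y t) y * φ y := by
  have h := K.integral_fderiv_eq_zero (F := fun y => G y * φ y) (hG.mul hφ.1) hφ.2.1.mul_left
    (fun y hy i hi hz => by rw [h0 y hy i hi hz, zero_mul]) ht
  have heq : (K.hull.indicator fun y => fderiv ℝ (fun y => G y * φ y) y t) =
      fun y => K.hull.indicator G y * fderiv ℝ φ y t +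
        K.hull.indicator (fun y => fderiv ℝ G y t) y * φ y := by
    ext y
    by_cases hy : y ∈ K.hull
    · simp only [Set.indicator_of_mem hy]
      rw [fderiv_fun_mul (hG.differentiable (by simp) y) (hφ.differentiable y)]
      simp only [add_apply, smul_apply, smul_eq_mul]
      ring
    · simp [Set.indicator_of_notMem hy]
  rw [heq, ← setIntegral_eq_integral_of_forall_compl_eq_zero (s := Ω)
    (fun y hy => by simp [hφ.eq_zero hy, hφ.fderiv_eq_zero hy]), integral_add] at h
  · linarith
  · exact (K.memL2_indicator Ω hG.continuous).integrable_mul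
      (hφ.continuous_fderiv_apply t) (hφ.hasCompactSupport_fderiv_apply t)
  · exact (K.memL2_indicator Ω ((hG.continuous_fderiv (by simp)).clm_apply
      continuous_const)).integrable_mul hφ.1.continuous hφ.2.1

theorem outer_isSymm (t : Plane) : (outer t).IsSymm := by
  ext i j; simp [outer, mul_comm]

theorem outer_smul (c : ℝ) (t : Plane) : outer (c • t) = (c * c) • outer t := by
  ext i j; simp [outer]; ring

theorem Tri.memHdiv_bubble (K : Tri) {c : Fin 3} {G : Plane → ℝ} (hG : ContDiff ℝ ∞ G)
    (h0 : ∀ y ∈ K.hull, ∀ i, i ≠ c → K.bary i y = 0 → G y = 0) {t : Plane}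
    (ht : (K.baryMap c).linear t = 0) (Ω : Set Plane) :
    MemHdiv Ω fun y => K.hull.indicator G y • outer t := by
  refine ⟨.of_forall fun y => (outer_isSymm t).smul _, fun i j => ?_, fun i => ?_⟩
  · have := (K.memL2_indicator Ω hG.continuous).mul_const (t i * t j)
    exact this
  · refine ⟨fun y => K.hull.indicator (fun y => fderiv ℝ G y t) y * t i,
      (K.memL2_indicator Ω ((hG.continuous_fderiv (by simp)).clm_apply continuous_const)).mul_const
        (t i), fun φ hφ => ?_⟩
    have h1 : ∀ y, ∑ j, (K.hull.indicator G y • outer t) i j * partialDeriv j φ y =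
        t i * (K.hull.indicator G y * fderiv ℝ φ y t) := fun y => by
      rw [← IsTest.sum_partialDeriv, Finset.mul_sum, Finset.mul_sum]
      refine Finset.sum_congr rfl fun j _ => ?_
      simp [outer]; ring
    have h2 : ∀ y, K.hull.indicator (fun y => fderiv ℝ G y t) y * t i * φ y =
        t i * (K.hull.indicator (fun y => fderiv ℝ G y t) y * φ y) := fun y => by ring
    simp_rw [h1, h2]
    rw [integral_const_mul, integral_const_mul, K.integral_bubble hG h0 ht hφ, mul_neg]

/-! ### Linear structure of the function spaces -/

section Linear

variable {Ω : Set Plane}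

theorem MemH1.add {u v : Plane → ℝ} (hu : MemH1 Ω u) (hv : MemH1 Ω v) :
    MemH1 Ω fun y => u y + v y := by
  refine ⟨MemLp.add hu.1 hv.1, fun j => ?_⟩
  obtain ⟨g, hg, h1⟩ := hu.2 j
  obtain ⟨g', hg', h2⟩ := hv.2 j
  refine ⟨fun y => g y + g' y, MemLp.add hg hg', fun φ hφ => ?_⟩
  have hc := hφ.continuous_partialDeriv j
  have hs := hφ.hasCompactSupport_partialDeriv j
  simp only [add_mul]
  rw [integral_add (hu.1.integrable_mul hc hs) (hv.1.integrable_mul hc hs),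
    integral_add (hg.integrable_mul hφ.1.continuous hφ.2.1)
      (hg'.integrable_mul hφ.1.continuous hφ.2.1), h1 φ hφ, h2 φ hφ]
  ring

theorem MemH1.const_mul {u : Plane → ℝ} (hu : MemH1 Ω u) (c : ℝ) :
    MemH1 Ω fun y => c * u y := by
  refine ⟨MemLp.const_mul hu.1 c, fun j => ?_⟩
  obtain ⟨g, hg, h1⟩ := hu.2 j
  refine ⟨fun y => c * g y, MemLp.const_mul hg c, fun φ hφ => ?_⟩
  simp only [mul_assoc]
  rw [integral_const_mul, integral_const_mul, h1 φ hφ, mul_neg]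

theorem MemH1Sym.add {σ τ : MatField} (hσ : MemH1Sym Ω σ) (hτ : MemH1Sym Ω τ) :
    MemH1Sym Ω (σ + τ) := by
  refine ⟨?_, fun i j => (hσ.2 i j).add (hτ.2 i j)⟩
  filter_upwards [hσ.1, hτ.1] with y h1 h2 using h1.add h2

theorem MemH1Sym.smul {σ : MatField} (hσ : MemH1Sym Ω σ) (c : ℝ) : MemH1Sym Ω (c • σ) := by
  refine ⟨?_, fun i j => (hσ.2 i j).const_mul c⟩
  filter_upwards [hσ.1] with y h1 using h1.smul c

theorem MemHdiv.congr {σ τ : MatField} (hσ : MemHdiv Ω σ) (h : σ =ᵐ[volume.restrict Ω] τ) :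
    MemHdiv Ω τ := by
  refine ⟨?_, fun i j => ?_, fun i => ?_⟩
  · filter_upwards [hσ.1, h] with y h1 h2 using h2 ▸ h1
  · exact MemLp.ae_eq (h.mono fun y hy => by rw [hy]) (hσ.2.1 i j)
  · obtain ⟨d, hd, h1⟩ := hσ.2.2 i
    refine ⟨d, hd, fun φ hφ => ?_⟩
    rw [← h1 φ hφ]
    exact integral_congr_ae (h.mono fun y hy => by simp only [hy])

theorem MemHdiv.integrable {σ : MatField} (hσ : MemHdiv Ω σ) {φ : Plane → ℝ} (hφ : IsTest Ω φ)
    (i : Fin 2) :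
    Integrable (fun y => ∑ j, σ y i j * partialDeriv j φ y) (volume.restrict Ω) :=
  integrable_finsetSum _ fun j _ => (hσ.2.1 i j).integrable_mul
    (hφ.continuous_partialDeriv _) (hφ.hasCompactSupport_partialDeriv _)

theorem MemHdiv.add {σ τ : MatField} (hσ : MemHdiv Ω σ) (hτ : MemHdiv Ω τ) :
    MemHdiv Ω (σ + τ) := by
  refine ⟨?_, fun i j => MemLp.add (hσ.2.1 i j) (hτ.2.1 i j), fun i => ?_⟩
  · filter_upwards [hσ.1, hτ.1] with y h1 h2 using h1.add h2
  · obtain ⟨d, hd, h1⟩ := hσ.2.2 i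
    obtain ⟨d', hd', h2⟩ := hτ.2.2 i
    refine ⟨fun y => d y + d' y, MemLp.add hd hd', fun φ hφ => ?_⟩
    simp only [Pi.add_apply, Matrix.add_apply, add_mul, Finset.sum_add_distrib]
    rw [integral_add (hσ.integrable hφ i) (hτ.integrable hφ i),
      integral_add (hd.integrable_mul hφ.1.continuous hφ.2.1)
        (hd'.integrable_mul hφ.1.continuous hφ.2.1), h1 φ hφ, h2 φ hφ]
    ring

theorem MemHdiv.zero : MemHdiv Ω 0 := by
  refine ⟨.of_forall fun y => Matrix.isSymm_zero, fun i j => MemLp.zero, fun i =>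
    ⟨0, MemLp.zero, fun φ _ => by simp⟩⟩

theorem MemHdiv.sum {ι : Type*} {s : Finset ι} {σ : ι → MatField}
    (h : ∀ i ∈ s, MemHdiv Ω (σ i)) : MemHdiv Ω (∑ i ∈ s, σ i) :=
  Finset.sum_induction σ (MemHdiv Ω) (fun _ _ => MemHdiv.add) MemHdiv.zero h

theorem MemH1Sym.memHdiv {σ : MatField} (hσ : MemH1Sym Ω σ) : MemHdiv Ω σ := by
  refine ⟨hσ.1, fun i j => (hσ.2 i j).1, fun i => ?_⟩
  choose g hg h1 using fun j => (hσ.2 i j).2 j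
  refine ⟨fun y => ∑ j, g j y, memLp_finsetSum _ fun j _ => hg j, fun φ hφ => ?_⟩
  simp only [Finset.sum_mul]
  rw [integral_finsetSum (f := fun j y => σ y i j * partialDeriv j φ y) _ fun j _ =>
      ((hσ.2 i j).1).integrable_mul
      (hφ.continuous_partialDeriv _) (hφ.hasCompactSupport_partialDeriv _),
    integral_finsetSum _ fun j _ => (hg j).integrable_mul hφ.1.continuous hφ.2.1,
    ← Finset.sum_neg_distrib]
  exact Finset.sum_congr rfl fun j _ => h1 j φ hφ

end Linear

theorem IsPolySymOn.add {k : ℕ} {K : Tri} {σ τ : MatField} (hσ : IsPolySymOn k K σ)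
    (hτ : IsPolySymOn k K τ) : IsPolySymOn k K (σ + τ) := by
  obtain ⟨P, h1, h2, h3⟩ := hσ
  obtain ⟨Q, h1', h2', h3'⟩ := hτ
  refine ⟨P + Q, h1.add h1', fun i j => (MvPolynomial.totalDegree_add _ _).trans
    (max_le (h2 i j) (h2' i j)), ?_⟩
  filter_upwards [h3, h3'] with y hy hy'
  rw [Pi.add_apply, hy, hy']
  ext i j; simp [evalAt]

theorem IsPolySymOn.smul {k : ℕ} {K : Tri} {σ : MatField} (hσ : IsPolySymOn k K σ) (c : ℝ) :
    IsPolySymOn k K (c • σ) := by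
  obtain ⟨P, h1, h2, h3⟩ := hσ
  refine ⟨c • P, h1.smul c, fun i j => (MvPolynomial.totalDegree_smul_le _ _).trans (h2 i j), ?_⟩
  filter_upwards [h3] with y hy
  rw [Pi.smul_apply, hy]
  ext i j; simp [evalAt]

theorem IsPolySymOn.mono {k : ℕ} {K L : Tri} (hs : L.hull ⊆ K.hull) {σ : MatField}
    (hσ : IsPolySymOn k K σ) : IsPolySymOn k L σ := by
  obtain ⟨P, h1, h2, h3⟩ := hσ
  exact ⟨P, h1, h2, ae_restrict_of_ae_restrict_of_subset hs h3⟩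

theorem IsBubbleOn.add {k : ℕ} {K : Tri} {σ τ : MatField} (hσ : IsBubbleOn k K σ)
    (hτ : IsBubbleOn k K τ) : IsBubbleOn k K (σ + τ) := by
  obtain ⟨p, h2, h3⟩ := hσ
  obtain ⟨q, h2', h3'⟩ := hτ
  refine ⟨p + q, fun i j => (MvPolynomial.totalDegree_add _ _).trans
    (max_le (h2 i j) (h2' i j)), ?_⟩
  filter_upwards [h3, h3'] with y hy hy'
  rw [Pi.add_apply, hy, hy']
  simp only [← Finset.sum_add_distrib, ← add_smul]
  simp [evalAt, mul_add]

theorem IsBubbleOn.smul {k : ℕ} {K : Tri} {σ : MatField} (hσ : IsBubbleOn k K σ) (c : ℝ) :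
    IsBubbleOn k K (c • σ) := by
  obtain ⟨p, h2, h3⟩ := hσ
  refine ⟨c • p, fun i j => (MvPolynomial.totalDegree_smul_le _ _).trans (h2 i j), ?_⟩
  filter_upwards [h3] with y hy
  rw [Pi.smul_apply, hy]
  simp only [Finset.smul_sum, smul_smul]
  refine Finset.sum_congr rfl fun i _ => Finset.sum_congr rfl fun j _ => ?_
  congr 1
  simp [evalAt]
  ring

theorem IsBubbleOn.zero (k : ℕ) (K : Tri) : IsBubbleOn k K 0 :=
  ⟨0, fun i j => by simp, .of_forall fun y => by simp [evalAt]⟩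

/-- The edge bubble `λ_i λ_j p`. -/
noncomputable def Tri.edgeBubble (K : Tri) (i j : Fin 3) (p : Poly) (y : Plane) : ℝ :=
  K.bary i y * K.bary j y * evalAt y p

theorem Tri.contDiff_edgeBubble (K : Tri) (i j : Fin 3) (p : Poly) :
    ContDiff ℝ ∞ (K.edgeBubble i j p) :=
  ((K.contDiff_bary i).mul (K.contDiff_bary j)).mul (contDiff_evalAt p)

theorem exists_third {i j : Fin 3} (hij : i ≠ j) :
    ∃ c, c ≠ i ∧ c ≠ j ∧ ∀ l, l ≠ c → l = i ∨ l = j := by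
  revert i j; decide

theorem IsTriangulation.exists_ae_eq_sum_edgeBubble {Ω : Set Plane} {T : Set Tri}
    (h : IsTriangulation Ω T) {k : ℕ} {σ : MatField} (hσ : ∀ K ∈ T, IsBubbleOn k K σ) :
    ∃ p : Tri → Fin 3 → Fin 3 → Poly, (∀ K ∈ T, ∀ i j, (p K i j).totalDegree ≤ k - 2) ∧
      ∑ K ∈ h.1.toFinset, ∑ i, ∑ j ∈ Finset.Ioi i, (fun y =>
        K.hull.indicator (K.edgeBubble i j (p K i j)) y • outer (K.points j - K.points i))
      =ᵐ[volume.restrict Ω] σ := by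
  choose! p hdeg hp using hσ
  have hae : ∀ᵐ y ∂volume.restrict Ω, ∀ K ∈ T, y ∈ K.hull → σ y = ∑ i, ∑ j ∈ Finset.Ioi i,
      K.edgeBubble i j (p K i j) y • outer (K.points j - K.points i) :=
    ae_restrict_of_ae ((ae_ball_iff h.1.countable).2 fun K hK =>
      (ae_restrict_iff' K.isClosed_hull.measurableSet).1 (hp K hK))
  refine ⟨p, hdeg, ?_⟩
  filter_upwards [hae, h.ae_restrict_inside] with y hy ⟨K, hK, hyK⟩
  rw [hy K hK hyK.mem_hull]
  have := h.sum_indicator_eq (fun K y => ∑ i, ∑ j ∈ Finset.Ioi i,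
      K.edgeBubble i j (p K i j) y • outer (K.points j - K.points i)) hK hyK
  rw [← this, Finset.sum_apply]
  refine Finset.sum_congr rfl fun L _ => ?_
  by_cases hyL : y ∈ L.hull
  · simp [Set.indicator_of_mem hyL, Finset.sum_apply]
  · simp [Set.indicator_of_notMem hyL, Finset.sum_apply]

theorem IsTriangulation.memHdiv_of_isBubbleOn {Ω : Set Plane} {T : Set Tri}
    (h : IsTriangulation Ω T) {k : ℕ} {σ : MatField} (hσ : ∀ K ∈ T, IsBubbleOn k K σ) :
    MemHdiv Ω σ := by
  obtain ⟨p, -, hp⟩ := h.exists_ae_eq_sum_edgeBubble hσ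
  refine MemHdiv.congr (MemHdiv.sum fun K _ => MemHdiv.sum fun i _ => MemHdiv.sum fun j hj => ?_) hp
  have hij : i ≠ j := (Finset.mem_Ioi.1 hj).ne
  obtain ⟨c, hci, hcj, hc⟩ := exists_third hij
  refine K.memHdiv_bubble (c := c) (K.contDiff_edgeBubble i j _) (fun y _ l hl h0 => ?_) ?_ Ω
  · rcases hc l hl with rfl | rfl <;> simp [edgeBubble, h0]
  · rw [affine_linear_sub, baryMap_apply, baryMap_apply, bary_points, bary_points, if_neg hci,
      if_neg hcj, sub_zero]

/-! ### The extended space up to equality almost everywhere -/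

/-- Decomposability of a field into a continuous part, a bubble part and a part in `E(T)`, almost
everywhere on `Ω`. -/
def Decomposable (Ω : Set Plane) (T₀ : Set Tri) (k : ℕ) (T : Set Tri) (τ : MatField) : Prop :=
  ∃ σc σb ε : MatField, τ =ᵐ[volume.restrict Ω] σc + σb + ε ∧ MemH1Sym Ω σc ∧
    (∀ K ∈ T, IsPolySymOn k K σc) ∧ (∀ K ∈ T, IsBubbleOn k K σb) ∧ ε ∈ edgeSpace Ω T₀ k T

section Decomposable

variable {Ω : Set Plane} {T₀ T : Set Tri} {k : ℕ}

theorem Decomposable.mem_extendedStressSpace (h : IsTriangulation Ω T) {τ : MatField}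
    (hτ : Decomposable Ω T₀ k T τ) : τ ∈ extendedStressSpace Ω T₀ k T := by
  obtain ⟨σc, σb, ε, h1, h2, h3, h4, h5⟩ := hτ
  have hae : τ - ε =ᵐ[volume.restrict Ω] σc + σb := by
    filter_upwards [h1] with y hy
    rw [Pi.sub_apply, hy]; simp
  refine ⟨τ - ε, ⟨?_, σc, σb, hae, h2, fun K hK => ⟨h3 K hK, h4 K hK⟩⟩, ε, h5, by simp⟩
  exact (h2.memHdiv.add (h.memHdiv_of_isBubbleOn h4)).congr hae.symm

theorem Decomposable.add {τ τ' : MatField} (h : Decomposable Ω T₀ k T τ)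
    (h' : Decomposable Ω T₀ k T τ') : Decomposable Ω T₀ k T (τ + τ') := by
  obtain ⟨σc, σb, ε, h1, h2, h3, h4, h5⟩ := h
  obtain ⟨σc', σb', ε', h1', h2', h3', h4', h5'⟩ := h'
  refine ⟨σc + σc', σb + σb', ε + ε', ?_, h2.add h2', fun K hK => (h3 K hK).add (h3' K hK),
    fun K hK => (h4 K hK).add (h4' K hK), Submodule.add_mem _ h5 h5'⟩
  filter_upwards [h1, h1'] with y hy hy'
  simp only [Pi.add_apply, hy, hy']
  abel

theorem Decomposable.smul {τ : MatField} (h : Decomposable Ω T₀ k T τ) (c : ℝ) :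
    Decomposable Ω T₀ k T (c • τ) := by
  obtain ⟨σc, σb, ε, h1, h2, h3, h4, h5⟩ := h
  refine ⟨c • σc, c • σb, c • ε, ?_, h2.smul c, fun K hK => (h3 K hK).smul c,
    fun K hK => (h4 K hK).smul c, Submodule.smul_mem _ c h5⟩
  filter_upwards [h1] with y hy
  simp only [Pi.add_apply, Pi.smul_apply, hy, smul_add]

theorem Decomposable.congr {τ τ' : MatField} (h : Decomposable Ω T₀ k T τ)
    (hae : τ =ᵐ[volume.restrict Ω] τ') : Decomposable Ω T₀ k T τ' := by
  obtain ⟨σc, σb, ε, h1, h2⟩ := h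
  exact ⟨σc, σb, ε, hae.symm.trans h1, h2⟩

theorem Decomposable.zero (h : IsTriangulation Ω T) : Decomposable Ω T₀ k T 0 := by
  refine ⟨0, 0, 0, by simp, ⟨.of_forall fun y => Matrix.isSymm_zero, fun i j => ?_⟩,
    fun K _ => ⟨0, Matrix.isSymm_zero, by simp, .of_forall fun y => ?_⟩,
    fun K _ => .zero k K, Submodule.zero_mem _⟩
  · exact h.memH1 (g := fun _ _ => 0) (fun _ _ => contDiff_const) fun _ _ _ _ => rfl
  · ext i j; simp [evalAt]

theorem Decomposable.sum (h : IsTriangulation Ω T) {ι : Type*} {s : Finset ι} {τ : ι → MatField}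
    (hτ : ∀ i ∈ s, Decomposable Ω T₀ k T (τ i)) : Decomposable Ω T₀ k T (∑ i ∈ s, τ i) :=
  Finset.sum_induction τ _ (fun _ _ => Decomposable.add) (Decomposable.zero h) hτ

end Decomposable

/-! ### Polynomials on edges -/

theorem exists_restrict_line (p : Poly) (x v : Plane) :
    ∃ g : Polynomial ℝ, g.natDegree ≤ p.totalDegree ∧ ∀ s, g.eval s = evalAt (x + s • v) p := by
  refine ⟨MvPolynomial.aeval
    (fun c => Polynomial.C (x c) + Polynomial.C (v c) * Polynomial.X) p, ?_, fun s => ?_⟩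
  · rw [MvPolynomial.aeval_def, MvPolynomial.eval₂_eq']
    refine Polynomial.natDegree_sum_le_of_forall_le _ _ fun m hm => ?_
    refine (Polynomial.natDegree_C_mul_le _ _).trans ((Polynomial.natDegree_prod_le _ _).trans ?_)
    refine le_trans ?_ (MvPolynomial.le_totalDegree hm)
    rw [Finsupp.sum_fintype _ _ fun _ => rfl]
    refine Finset.sum_le_sum fun i _ => ?_
    have h1 : (Polynomial.C (x i) + Polynomial.C (v i) * Polynomial.X).natDegree ≤ 1 := by
      compute_degree
    exact Polynomial.natDegree_pow_le.trans (by nlinarith)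
  · unfold evalAt
    rw [← Polynomial.coe_evalRingHom, MvPolynomial.aeval_def, MvPolynomial.hom_eval₂]
    congr 1
    · ext; simp
    · ext i; simp; ring

theorem totalDegree_aeval_le {P : Poly} (hP : P.totalDegree ≤ 1) (g : Polynomial ℝ) :
    (Polynomial.aeval P g).totalDegree ≤ g.natDegree := by
  rw [Polynomial.aeval_eq_sum_range]
  refine MvPolynomial.totalDegree_finsetSum_le fun i hi => ?_
  refine (MvPolynomial.totalDegree_smul_le _ _).trans
    ((MvPolynomial.totalDegree_pow _ _).trans ?_)
  have := Finset.mem_range.1 hi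
  nlinarith

theorem evalAt_aeval (P : Poly) (g : Polynomial ℝ) (y : Plane) :
    evalAt y (Polynomial.aeval P g) = g.eval (evalAt y P) := by
  rw [Polynomial.aeval_eq_sum_range, Polynomial.eval_eq_sum_range]
  simp [evalAt]

namespace Tri

theorem eq_add_smul_of_edge (K : Tri) {i j : Fin 3} (hij : i ≠ j) {y : Plane}
    (hy : ∀ l, l ≠ i → l ≠ j → K.bary l y = 0) :
    K.bary i y = 1 - K.bary j y ∧
      y = K.points i + K.bary j y • (K.points j - K.points i) := by
  have h1 := K.sum_bary y
  have h2 := K.sum_bary_smul y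
  rw [Finset.sum_eq_add i j hij (fun l _ hl => hy l hl.1 hl.2) (by simp) (by simp)] at h1
  rw [Finset.sum_eq_add i j hij (fun l _ hl => by rw [hy l hl.1 hl.2, zero_smul])
    (by simp) (by simp)] at h2
  refine ⟨by linarith, ?_⟩
  nth_rewrite 1 [← h2]
  rw [show K.bary i y = 1 - K.bary j y by linarith]
  module

/-- A polynomial that vanishes at the end points of an edge is an edge bubble on that edge. -/
theorem exists_edge_factor (K : Tri) {i j : Fin 3} (hij : i ≠ j) {p : Poly} {k : ℕ}
    (hp : p.totalDegree ≤ k) (hi : evalAt (K.points i) p = 0) (hj : evalAt (K.points j) p = 0) :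
    ∃ q : Poly, q.totalDegree ≤ k - 2 ∧
      ∀ y, (∀ l, l ≠ i → l ≠ j → K.bary l y = 0) → evalAt y p = K.edgeBubble i j q y := by
  obtain ⟨g, hg, hge⟩ := exists_restrict_line p (K.points i) (K.points j - K.points i)
  obtain ⟨g₁, hg₁⟩ : (Polynomial.X - Polynomial.C 0) ∣ g := by
    rw [Polynomial.dvd_iff_isRoot, Polynomial.IsRoot, hge, zero_smul, add_zero, hi]
  obtain ⟨g₂, hg₂⟩ : (Polynomial.X - Polynomial.C 1) ∣ g₁ := by
    rw [Polynomial.dvd_iff_isRoot, Polynomial.IsRoot]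
    have := hge 1
    rw [one_smul, add_sub_cancel, hj, hg₁] at this
    simpa using this
  have hdeg : g₂.natDegree ≤ k - 2 := by
    by_cases h0 : g₂ = 0
    · simp [h0]
    · have h1 : g.natDegree = 1 + (1 + g₂.natDegree) := by
        have hne : g₁ ≠ 0 := by
          rw [hg₂]; exact mul_ne_zero (Polynomial.X_sub_C_ne_zero 1) h0
        rw [hg₁, Polynomial.natDegree_mul (Polynomial.X_sub_C_ne_zero 0) hne, hg₂,
          Polynomial.natDegree_mul (Polynomial.X_sub_C_ne_zero 1) h0,
          Polynomial.natDegree_X_sub_C, Polynomial.natDegree_X_sub_C]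
      omega
  refine ⟨-Polynomial.aeval (K.baryPoly j) g₂, ?_, fun y hy => ?_⟩
  · rw [MvPolynomial.totalDegree_neg]
    exact (totalDegree_aeval_le (K.totalDegree_baryPoly j) g₂).trans hdeg
  · obtain ⟨h1, h2⟩ := K.eq_add_smul_of_edge hij hy
    have h3 := hge (K.bary j y)
    rw [← h2, hg₁, hg₂] at h3
    have h4 : evalAt y (-Polynomial.aeval (K.baryPoly j) g₂) = -g₂.eval (K.bary j y) := by
      rw [← K.evalAt_baryPoly, ← evalAt_aeval]
      simp [evalAt]
    rw [edgeBubble, h4, h1, ← h3]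
    simp
    ring

/-- A polynomial of degree `k` that vanishes at all Lagrange nodes except possibly a vertex
vanishes on the edge opposite to that vertex. -/
theorem eq_zero_on_opposite_edge (K : Tri) {a : Fin 3} {p : Poly} {k : ℕ} (hk : 0 < k)
    (hp : p.totalDegree ≤ k)
    (h0 : ∀ z ∈ lagrangeNodes k K, z ≠ K.points a → evalAt z p = 0) {y : Plane}
    (hy : K.bary a y = 0) : evalAt y p = 0 := by
  obtain ⟨i, j, hij, hia, hja, hc⟩ : ∃ i j : Fin 3, i ≠ j ∧ i ≠ a ∧ j ≠ a ∧
      ∀ l, l ≠ i → l ≠ j → l = a := by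
    clear h0 hy; revert a; decide
  obtain ⟨g, hg, hge⟩ := exists_restrict_line p (K.points i) (K.points j - K.points i)
  have hk' : (k : ℝ) ≠ 0 := by exact_mod_cast hk.ne'
  have hg0 : g = 0 := by
    refine Polynomial.eq_zero_of_natDegree_lt_card_of_eval_eq_zero g
      (f := fun m : Fin (k + 1) => (m : ℝ) / k) (fun m n hmn => ?_) (fun m => ?_) (by simp; omega)
    · have : (m : ℝ) = n := by field_simp at hmn; exact hmn
      exact Fin.ext (by exact_mod_cast this)
    · rw [hge]
      have hm : (m : ℕ) ≤ k := Nat.lt_succ_iff.1 m.2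
      set w : Fin 3 → ℕ := fun l => if l = i then k - m else if l = j then m else 0 with hw
      have hwi : w i = k - m := by simp [hw]
      have hwj : w j = m := by simp [hw, hij.symm]
      have hw0 : ∀ l, l ≠ i ∧ l ≠ j → w l = 0 := fun l hl => by simp [hw, hl.1, hl.2]
      have hws : ∑ l, w l = k := by
        rw [Finset.sum_eq_add i j hij (fun l _ hl => hw0 l hl) (by simp) (by simp), hwi, hwj]
        omega
      have hz : K.points i + ((m : ℝ) / k) • (K.points j - K.points i) =
          ∑ l, ((w l : ℝ) / k) • K.points l := by
        rw [Finset.sum_eq_add i j hij (fun l _ hl => by rw [hw0 l hl]; simp) (by simp) (by simp),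
          hwi, hwj, Nat.cast_sub hm, sub_div, div_self hk']
        module
      rw [hz]
      refine h0 _ ⟨w, hws, rfl⟩ fun heq => ?_
      have h1 : ∑ l, (w l : ℝ) / k = 1 := by
        rw [← Finset.sum_div, ← Nat.cast_sum, hws, div_self hk']
      have := K.bary_sum_smul h1 a
      rw [heq, bary_points, if_pos rfl, hw0 a ⟨hia.symm, hja.symm⟩] at this
      simp at this
  obtain ⟨-, h2⟩ := K.eq_add_smul_of_edge hij (y := y) fun l h1 h2 => by rw [hc l h1 h2, hy]
  rw [h2, ← hge, hg0, Polynomial.eval_zero]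

end Tri

/-! ### Nodal basis functions at vertices -/

/-- The univariate polynomial of degree `k` which is one at `1` and zero at `m / k` for `m < k`. The
nodal basis function at a vertex is its composition with the piecewise linear hat function. -/
noncomputable def nodalPoly (k : ℕ) : Polynomial ℝ :=
  ∏ j ∈ Finset.range k, Polynomial.C ((k - j : ℝ)⁻¹) *
    (Polynomial.C (k : ℝ) * Polynomial.X - Polynomial.C (j : ℝ))

theorem natDegree_nodalPoly_le (k : ℕ) : (nodalPoly k).natDegree ≤ k := by
  refine (Polynomial.natDegree_prod_le _ _).trans ?_
  refine (Finset.sum_le_card_nsmul _ _ 1 fun j _ => ?_).trans (by simp)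
  refine (Polynomial.natDegree_C_mul_le _ _).trans ?_
  compute_degree

theorem eval_nodalPoly (k : ℕ) (s : ℝ) :
    (nodalPoly k).eval s = ∏ j ∈ Finset.range k, (k - j : ℝ)⁻¹ * (k * s - j) := by
  simp [nodalPoly, Polynomial.eval_prod]

theorem eval_nodalPoly_one (k : ℕ) : (nodalPoly k).eval 1 = 1 := by
  rw [eval_nodalPoly]
  refine Finset.prod_eq_one fun j hj => ?_
  have : (j : ℝ) < k := by exact_mod_cast Finset.mem_range.1 hj
  rw [mul_one, inv_mul_cancel₀ (by linarith)]

theorem eval_nodalPoly_div {k m : ℕ} (hm : m < k) : (nodalPoly k).eval ((m : ℝ) / k) = 0 := by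
  have hk : (k : ℝ) ≠ 0 := by exact_mod_cast (by omega : k ≠ 0)
  rw [eval_nodalPoly]
  exact Finset.prod_eq_zero (Finset.mem_range.2 hm) (by field_simp; simp)

theorem eval_nodalPoly_zero {k : ℕ} (hk : 0 < k) : (nodalPoly k).eval 0 = 0 := by
  simpa using eval_nodalPoly_div (m := 0) hk

/-- The restriction to `K` of the nodal basis function at the vertex `points i`. -/
noncomputable def Tri.vertexPoly (K : Tri) (k : ℕ) (i : Fin 3) : Poly :=
  Polynomial.aeval (K.baryPoly i) (nodalPoly k)

theorem Tri.totalDegree_vertexPoly (K : Tri) (k : ℕ) (i : Fin 3) :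
    (K.vertexPoly k i).totalDegree ≤ k :=
  (totalDegree_aeval_le (K.totalDegree_baryPoly i) _).trans (natDegree_nodalPoly_le k)

theorem Tri.evalAt_vertexPoly (K : Tri) (k : ℕ) (i : Fin 3) (y : Plane) :
    evalAt y (K.vertexPoly k i) = (nodalPoly k).eval (K.bary i y) := by
  rw [vertexPoly, evalAt_aeval, evalAt_baryPoly]

/-- Functions on the triangles that agree on the overlaps come from one function. -/
theorem exists_glue {T : Set Tri} {f : Tri → Plane → ℝ}
    (hf : ∀ K ∈ T, ∀ L ∈ T, ∀ y ∈ K.hull, y ∈ L.hull → f K y = f L y) :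
    ∃ u : Plane → ℝ, ∀ K ∈ T, ∀ y ∈ K.hull, u y = f K y := by
  classical
  refine ⟨fun y => if h : ∃ K ∈ T, y ∈ K.hull then f h.choose y else 0, fun K hK y hy => ?_⟩
  have h : ∃ K ∈ T, y ∈ K.hull := ⟨K, hK, hy⟩
  simp only [dif_pos h]
  exact hf _ h.choose_spec.1 _ hK y h.choose_spec.2 hy

theorem Conforming.exists_isNodalBasis {T : Set Tri} (hT : Conforming T) {k : ℕ} (hk : 0 < k)
    {z : Plane} (hz : z ∈ vertices T) :
    ∃ φ, IsNodalBasis k T z φ ∧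
      (∀ K ∈ T, ∀ i, K.points i = z → ∀ y ∈ K.hull, φ y = evalAt y (K.vertexPoly k i)) ∧
      ∀ K ∈ T, z ∉ Set.range K.points → ∀ y ∈ K.hull, φ y = 0 := by
  classical
  set f : Tri → Plane → ℝ := fun K y =>
    ∑ i, if K.points i = z then (nodalPoly k).eval (K.bary i y) else 0 with hf
  have hfi : ∀ (K : Tri) (i : Fin 3), K.points i = z → ∀ y,
      f K y = (nodalPoly k).eval (K.bary i y) := by
    intro K i hi y
    simp only [hf]
    rw [Finset.sum_eq_single i, if_pos hi]
    · intro j _ hj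
      exact if_neg fun h => hj (K.points_injective (h.trans hi.symm))
    · simp
  have hf0 : ∀ K : Tri, (∀ i, K.points i ≠ z) → ∀ y, f K y = 0 := fun K h y =>
    Finset.sum_eq_zero fun i _ => if_neg (h i)
  -- where the value is nonzero, the vertex is common to both triangles
  have hne : ∀ K ∈ T, ∀ L ∈ T, ∀ y ∈ K.hull, y ∈ L.hull → f K y ≠ 0 → f K y = f L y := by
    intro K hK L hL y hyK hyL hy
    by_cases h : ∃ i, K.points i = z
    · obtain ⟨i, hi⟩ := h
      have hb : K.bary i y ≠ 0 := fun hb => hy (by rw [hfi K i hi, hb, eval_nodalPoly_zero hk])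
      obtain ⟨j, hj, hbj⟩ := hT.exists_common hK hL hyK hyL hb
      rw [hfi K i hi, hfi L j (hj.trans hi), hbj]
    · push Not at h
      exact absurd (hf0 K h y) hy
  obtain ⟨φ, hφ⟩ := exists_glue (T := T) (f := f) (by
    intro K hK L hL y hyK hyL
    by_cases h1 : f K y = 0
    · by_cases h2 : f L y = 0
      · rw [h1, h2]
      · exact (hne L hL K hK y hyL hyK h2).symm
    · exact hne K hK L hL y hyK hyL h1)
  refine ⟨φ, ⟨fun K hK => ?_, ?_, fun K hK w hw hwz => ?_⟩, fun K hK i hi y hy => ?_,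
    fun K hK hz y hy => ?_⟩
  · by_cases h : ∃ i, K.points i = z
    · obtain ⟨i, hi⟩ := h
      exact ⟨K.vertexPoly k i, K.totalDegree_vertexPoly k i, fun y hy => by
        rw [hφ K hK y hy, hfi K i hi, K.evalAt_vertexPoly]⟩
    · push Not at h
      exact ⟨0, by simp, fun y hy => by rw [hφ K hK y hy, hf0 K h]; simp [evalAt]⟩
  · obtain ⟨K, hK, i, rfl⟩ := hz
    rw [hφ K hK _ (K.points_mem_hull i), hfi K i rfl, bary_points, if_pos rfl, eval_nodalPoly_one]
  · obtain ⟨a, ha, rfl⟩ := hw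
    have hk' : (k : ℝ) ≠ 0 := by exact_mod_cast hk.ne'
    have h1 : ∑ l, (a l : ℝ) / k = 1 := by
      rw [← Finset.sum_div, ← Nat.cast_sum, ha, div_self hk']
    rw [hφ K hK _ (K.sum_smul_mem_hull (fun i => by positivity) h1)]
    by_cases h : ∃ i, K.points i = z
    · obtain ⟨i, hi⟩ := h
      rw [hfi K i hi, K.bary_sum_smul h1]
      refine eval_nodalPoly_div (lt_of_le_of_ne (ha ▸ Finset.single_le_sum
        (fun _ _ => Nat.zero_le _) (Finset.mem_univ i)) fun hai => hwz ?_)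
      rw [← hi]
      refine K.eq_points_of_bary_eq_zero fun j hj => ?_
      rw [K.bary_sum_smul h1]
      have : a j = 0 := by
        have := Finset.add_le_sum (f := a) (s := Finset.univ) (fun _ _ => Nat.zero_le _)
          (Finset.mem_univ i) (Finset.mem_univ j) hj.symm
        omega
      rw [this]; simp
    · push Not at h
      exact hf0 K h _
  · rw [hφ K hK y hy, hfi K i hi, K.evalAt_vertexPoly]
  · rw [hφ K hK y hy, hf0 K fun i hi => hz ⟨i, hi⟩]

/-! ### Tangents and normals of an edge -/

theorem inner_perp (v s : Plane) : inner ℝ v (perp s) = -s 1 * v 0 + s 0 * v 1 := by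
  simp [perp, PiLp.inner_apply]

theorem exists_inner_perp_eq {f : Plane →ₗ[ℝ] ℝ} {v₀ : Plane} (hf : f v₀ ≠ 0) {s : Plane}
    (hs : s ≠ 0) (hfs : f s = 0) :
    ∃ γ : ℝ, γ ≠ 0 ∧ ∀ v, inner ℝ v (perp s) = γ * f v := by
  have hlin : ∀ v, f v = f (EuclideanSpace.single 0 1) * v 0 +
      f (EuclideanSpace.single 1 1) * v 1 := by
    intro v
    have hv : v = v 0 • EuclideanSpace.single 0 (1 : ℝ) + v 1 • EuclideanSpace.single 1 1 := by
      ext i; fin_cases i <;> simp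
    conv_lhs => rw [hv]
    simp [mul_comm]
  generalize f (EuclideanSpace.single 0 1) = α at hlin
  generalize f (EuclideanSpace.single 1 1) = β at hlin
  rw [hlin] at hfs hf
  have hs' : s 0 ≠ 0 ∨ s 1 ≠ 0 := by
    by_contra! hc
    exact hs (by ext i; fin_cases i <;> simp [hc.1, hc.2])
  by_cases hα : α = 0
  · have hβ : β ≠ 0 := by rintro rfl; simp [hα] at hf
    have hs1 : s 1 = 0 := by
      rw [hα, zero_mul, zero_add] at hfs
      exact (mul_eq_zero.1 hfs).resolve_left hβ
    refine ⟨s 0 / β, div_ne_zero (hs'.resolve_right (not_not.2 hs1)) hβ, fun v => ?_⟩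
    rw [inner_perp, hlin, hα, hs1]
    field_simp
    ring
  · have hs0 : s 0 = -β * s 1 / α := by field_simp; linarith
    have hs1 : s 1 ≠ 0 := by
      intro h1
      rw [h1, mul_zero, zero_div] at hs0
      simp [h1, hs0] at hs'
    refine ⟨-s 1 / α, div_ne_zero (neg_ne_zero.2 hs1) hα, fun v => ?_⟩
    rw [inner_perp, hlin, hs0]
    field_simp
    ring

theorem linear_ne_zero {h : Plane →ᵃ[ℝ] ℝ} {v z : Plane} (hv : h v ≠ 0) (hz : h z = 0) :
    h.linear (v - z) ≠ 0 := by
  rwa [affine_linear_sub, hz, sub_zero]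

theorem Tri.edgeTangent_ne_zero (K : Tri) : edgeTangent K ≠ 0 := by
  have : K.points 1 - K.points 0 ≠ 0 :=
    sub_ne_zero.2 (K.points_injective.ne (by decide))
  exact smul_ne_zero (inv_ne_zero (norm_ne_zero_iff.2 this)) this

theorem Tri.linear_edgeTangent (K : Tri) {h : Plane →ᵃ[ℝ] ℝ}
    (h01 : h (K.points 0) = h (K.points 1)) : h.linear (edgeTangent K) = 0 := by
  rw [edgeTangent, map_smul, affine_linear_sub, h01, sub_self, smul_zero]

/-- If the refinement edge of `K` lies on a level line of `h`, then the normal coordinate of that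
edge is a multiple of `h`. -/
theorem Tri.exists_inner_normal (K : Tri) {h : Plane →ᵃ[ℝ] ℝ} {v : Plane} (hv : h v ≠ 0)
    (h0 : h (K.points 0) = 0) (h1 : h (K.points 1) = 0) :
    ∃ γ : ℝ, γ ≠ 0 ∧ ∀ x y, inner ℝ (y - x) (perp (edgeTangent K)) = γ * (h y - h x) := by
  obtain ⟨γ, hγ, hin⟩ := exists_inner_perp_eq (linear_ne_zero hv h0) K.edgeTangent_ne_zero
    (K.linear_edgeTangent (h0.trans h1.symm))
  exact ⟨γ, hγ, fun x y => by rw [hin, affine_linear_sub]⟩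

/-- The kernel of a nonzero functional on the plane is a line, so it has only one rank-one matrix
up to a factor. -/
theorem exists_outer_eq {f : Plane →ₗ[ℝ] ℝ} {v₀ : Plane} (hf : f v₀ ≠ 0) {s t : Plane}
    (hs : s ≠ 0) (hfs : f s = 0) (ht : f t = 0) : ∃ a : ℝ, outer t = a • outer s := by
  obtain ⟨γ, hγ, hin⟩ := exists_inner_perp_eq hf hs hfs
  have h2 := hin t
  rw [ht, mul_zero, inner_perp] at h2
  obtain ⟨b, rfl⟩ : ∃ b : ℝ, t = b • s := by
    by_cases hs0 : s 0 = 0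
    · have hs1 : s 1 ≠ 0 := fun hs1 => hs (by ext i; fin_cases i <;> simp [hs0, hs1])
      have ht0 : t 0 = 0 := by
        rw [hs0, zero_mul, add_zero] at h2
        exact (mul_eq_zero.1 h2).resolve_left (neg_ne_zero.2 hs1)
      exact ⟨t 1 / s 1, by ext i; fin_cases i <;> simp [hs0, ht0, hs1]⟩
    · refine ⟨t 0 / s 0, ?_⟩
      have : t 1 = t 0 / s 0 * s 1 := by field_simp; linarith
      ext i; fin_cases i <;> simp [this, hs0]
  exact ⟨b * b, outer_smul b s⟩

/-! ### Continuous parts and bubble parts -/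

theorem IsTriangulation.decomposable_of_agree {Ω : Set Plane} {T₀ T : Set Tri}
    (hT : IsTriangulation Ω T) {k : ℕ} {r : Tri → Poly} (hdeg : ∀ K ∈ T, (r K).totalDegree ≤ k)
    (hr : ∀ K ∈ T, ∀ L ∈ T, ∀ y ∈ K.hull, y ∈ L.hull → evalAt y (r K) = evalAt y (r L))
    {A : Matrix (Fin 2) (Fin 2) ℝ} (hA : A.IsSymm) {τ : MatField}
    (hτ : ∀ K ∈ T, ∀ y, K.Inside y → τ y = evalAt y (r K) • A) : Decomposable Ω T₀ k T τ := by
  obtain ⟨u, hu⟩ := exists_glue (f := fun K y => evalAt y (r K)) hr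
  refine ⟨fun y => u y • A, 0, 0, hT.ae_eq_of_inside fun K hK y hy => ?_,
    ⟨.of_forall fun y => hA.smul _, fun i j => ?_⟩, fun K hK =>
    ⟨Matrix.of fun i j => MvPolynomial.C (A i j) * r K, ?_, fun i j => ?_, ?_⟩,
    fun K _ => .zero k K, Submodule.zero_mem _⟩
  · simp [hτ K hK y hy, hu K hK y hy.mem_hull]
  · have := (hT.memH1 (fun K _ => contDiff_evalAt (r K)) hu).const_mul (A i j)
    simpa [mul_comm] using this
  · ext i j
    simp [hA.apply i j]
  · refine (MvPolynomial.totalDegree_mul _ _).trans ?_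
    rw [MvPolynomial.totalDegree_C, zero_add]
    exact hdeg K hK
  · rw [ae_restrict_iff' K.isClosed_hull.measurableSet]
    refine .of_forall fun y hy => ?_
    ext i j
    simp [hu K hK y hy, evalAt, mul_comm]

theorem IsTriangulation.decomposable_of_isBubbleOn {Ω : Set Plane} {T₀ T : Set Tri}
    (hT : IsTriangulation Ω T) {k : ℕ} {τ : MatField} (hτ : ∀ K ∈ T, IsBubbleOn k K τ) :
    Decomposable Ω T₀ k T τ := by
  obtain ⟨σc, σb, ε, h1, h2, h3, -, -⟩ := Decomposable.zero (T₀ := T₀) (k := k) hT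
  refine ⟨0, τ, 0, by simp, ?_, ?_, hτ, Submodule.zero_mem _⟩
  · simpa using h2.smul 0
  · exact fun K hK => by simpa using (h3 K hK).smul 0

theorem IsTriangulation.decomposable_of_mem_edgeSpace {Ω : Set Plane} {T₀ T : Set Tri}
    (hT : IsTriangulation Ω T) {k : ℕ} {τ : MatField} (hτ : τ ∈ edgeSpace Ω T₀ k T) :
    Decomposable Ω T₀ k T τ := by
  obtain ⟨σc, σb, ε, h1, h2, h3, -, -⟩ := Decomposable.zero (T₀ := T₀) (k := k) hT
  refine ⟨0, 0, τ, by simp, ?_, ?_, fun K _ => .zero k K, hτ⟩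
  · simpa using h2.smul 0
  · exact fun K hK => by simpa using (h3 K hK).smul 0

theorem Tri.isBubbleOn_of_edge (K : Tri) {i j : Fin 3} (hij : i ≠ j) {k : ℕ} {q : Poly}
    (hq : q.totalDegree ≤ k - 2) {τ : MatField}
    (hτ : ∀ y, K.Inside y → τ y = K.edgeBubble i j q y • outer (K.points j - K.points i)) :
    IsBubbleOn k K τ := by
  wlog hlt : i < j generalizing i j
  · refine this hij.symm (fun y hy => ?_) (lt_of_le_of_ne (not_lt.1 hlt) hij.symm)
    rw [hτ y hy, ← neg_sub (K.points i), ← neg_one_smul ℝ (K.points i - K.points j), outer_smul]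
    simp [edgeBubble, mul_comm (K.bary i y)]
  classical
  refine ⟨fun a b => if a = i ∧ b = j then q else 0, fun a b => ?_, ?_⟩
  · dsimp only
    split_ifs
    · exact hq
    · simp
  · filter_upwards [K.ae_restrict_inside] with y hy
    rw [hτ y hy, Finset.sum_eq_single i, Finset.sum_eq_single j]
    · simp [edgeBubble]
    · intro b _ hb; simp [hb, evalAt]
    · intro h; exact absurd (Finset.mem_Ioi.2 hlt) h
    · intro a _ ha
      exact Finset.sum_eq_zero fun b _ => by simp [ha, evalAt]
    · simp

theorem Tri.isBubbleOn_of_tangent (K : Tri) {h : Plane →ᵃ[ℝ] ℝ} {v : Plane} (hv : h v ≠ 0)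
    {i j : Fin 3} (hij : i ≠ j) (hi : h (K.points i) = 0) (hj : h (K.points j) = 0) {t : Plane}
    (ht : h.linear t = 0) {k : ℕ} {q : Poly} (hq : q.totalDegree ≤ k - 2) {τ : MatField}
    (hτ : ∀ y, K.Inside y → τ y = K.edgeBubble i j q y • outer t) : IsBubbleOn k K τ := by
  have hs : K.points j - K.points i ≠ 0 := sub_ne_zero.2 (K.points_injective.ne hij.symm)
  obtain ⟨a, ha⟩ := exists_outer_eq (linear_ne_zero hv hi) hs
    (by rw [affine_linear_sub, hi, hj, sub_self]) ht
  refine K.isBubbleOn_of_edge hij (q := MvPolynomial.C a * q) ?_ fun y hy => ?_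
  · refine (MvPolynomial.totalDegree_mul _ _).trans ?_
    rwa [MvPolynomial.totalDegree_C, zero_add]
  · rw [hτ y hy, ha, smul_smul]
    congr 1
    simp [edgeBubble, evalAt]
    ring

/-- A polynomial which vanishes at the vertices on a supporting line agrees on that line with a
bubble of the edge on the line, or with zero if there is no such edge. -/
theorem Tri.exists_edgeBubble_eq (K : Tri) {h : Plane →ᵃ[ℝ] ℝ} {v : Plane} (hv : h v ≠ 0)
    (hK : ∀ i, 0 ≤ h (K.points i)) {k : ℕ} {p : Poly} (hp : p.totalDegree ≤ k)
    (h0 : ∀ i, h (K.points i) = 0 → evalAt (K.points i) p = 0) :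
    ∃ (i j : Fin 3) (q : Poly), i ≠ j ∧ q.totalDegree ≤ k - 2 ∧
      (q ≠ 0 → h (K.points i) = 0 ∧ h (K.points j) = 0) ∧
      ∀ y ∈ K.hull, h y = 0 → evalAt y p = K.edgeBubble i j q y := by
  by_cases hc : ∃ c, ∀ i, i ≠ c → h (K.points i) = 0
  · obtain ⟨c, hc⟩ := hc
    obtain ⟨i, j, hij, hic, hjc, hcc⟩ : ∃ i j : Fin 3, i ≠ j ∧ i ≠ c ∧ j ≠ c ∧
        ∀ l, l ≠ i → l ≠ j → l = c := by
      clear hc; revert c; decide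
    have hpos := K.pos_of_edge_eq_zero hv (hK c) hc
    obtain ⟨q, hq, hqe⟩ := K.exists_edge_factor hij hp (h0 i (hc i hic)) (h0 j (hc j hjc))
    refine ⟨i, j, q, hij, hq, fun _ => ⟨hc i hic, hc j hjc⟩, fun y hy hy0 => hqe y ?_⟩
    intro l hli hlj
    rw [hcc l hli hlj]
    exact K.bary_eq_zero_of_pos hK hy hy0 hpos
  · refine ⟨0, 1, 0, by decide, by simp, fun h => absurd rfl h, fun y hy hy0 => ?_⟩
    -- the line meets the triangle in a vertex only
    have hb : ∀ i, K.bary i y ≠ 0 → h (K.points i) = 0 := fun i hi => by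
      by_contra hne
      exact hi (K.bary_eq_zero_of_pos hK hy hy0 (lt_of_le_of_ne (hK i) (Ne.symm hne)))
    obtain ⟨i, hi⟩ : ∃ i, K.bary i y ≠ 0 := by
      by_contra! hall
      have := K.sum_bary y
      simp [hall] at this
    have hy' : y = K.points i := K.eq_points_of_bary_eq_zero fun j hj => by
      by_contra hne
      obtain ⟨c, -, -, hcc⟩ := exists_third hj
      exact hc ⟨c, fun l hl => by rcases hcc l hl with rfl | rfl; exacts [hb _ hne, hb _ hi]⟩
    rw [hy', h0 i (hb i hi)]
    simp [edgeBubble, evalAt]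

/-! ### One-sided piecewise polynomials -/

/-- A piecewise polynomial `p` on a part `S` of the mesh `T`, on the side `0 ≤ h` of the line
`h = 0`, whose extension by zero jumps across that line only. At the vertices on the line where it
is nonzero, the one-sided basis functions with the direction of the line are available. -/
structure OneSidedSpline (Ω : Set Plane) (T₀ : Set Tri) (k : ℕ) (T : Set Tri)
    (h : Plane →ᵃ[ℝ] ℝ) (S : Set Tri) (p : Tri → Poly) : Prop where
  subset : S ⊆ T
  ne_zero : ∃ v, h v ≠ 0
  degree : ∀ L ∈ S, (p L).totalDegree ≤ k
  nonneg : ∀ L ∈ S, ∀ i, 0 ≤ h (L.points i)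
  agree : ∀ L ∈ S, ∀ M ∈ S, ∀ y ∈ L.hull, y ∈ M.hull → evalAt y (p L) = evalAt y (p M)
  nonpos : ∀ L ∈ S, ∀ M ∈ T, M ∉ S → ∀ y ∈ L.hull, y ∈ M.hull → evalAt y (p L) ≠ 0 →
    ∀ i, h (M.points i) ≤ 0
  vertex : ∀ L ∈ S, ∀ i, h (L.points i) = 0 → evalAt (L.points i) (p L) ≠ 0 →
    L.points i ∈ Ω ∧ L.points i ∉ vertices T₀ ∧
      ∃ K, Generated T₀ K ∧ K.refMid = L.points i ∧ h (K.points 0) = 0 ∧ h (K.points 1) = 0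

namespace OneSidedSpline

variable {Ω : Set Plane} {T₀ T S : Set Tri} {k : ℕ} {h : Plane →ᵃ[ℝ] ℝ} {p : Tri → Poly}

/-- The values of the spline at the vertices on the line, extended by zero to all other points. -/
theorem exists_trace (H : OneSidedSpline Ω T₀ k T h S p) : ∃ β : Plane → ℝ,
    (∀ L ∈ S, ∀ i, h (L.points i) = 0 → β (L.points i) = evalAt (L.points i) (p L)) ∧
    ∀ z, β z ≠ 0 → h z = 0 ∧ ∃ L ∈ S, ∃ i, L.points i = z ∧ evalAt z (p L) ≠ 0 := by
  classical
  refine ⟨fun z => if hz : ∃ L, L ∈ S ∧ z ∈ Set.range L.points ∧ h z = 0 then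
    evalAt z (p hz.choose) else 0, fun L hL i hi => ?_, fun z hz => ?_⟩
  · have hz : ∃ M, M ∈ S ∧ L.points i ∈ Set.range M.points ∧ h (L.points i) = 0 :=
      ⟨L, hL, ⟨i, rfl⟩, hi⟩
    simp only [dif_pos hz]
    obtain ⟨h1, ⟨j, hj⟩, h3⟩ := hz.choose_spec
    exact H.agree _ h1 L hL _ (Set.mem_of_eq_of_mem hj.symm (points_mem_hull _ j))
      (L.points_mem_hull i)
  · by_cases h' : ∃ L, L ∈ S ∧ z ∈ Set.range L.points ∧ h z = 0
    · simp only [dif_pos h'] at hz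
      obtain ⟨h1, ⟨j, hj⟩, h3⟩ := h'.choose_spec
      exact ⟨h3, _, h1, j, hj, hz⟩
    · simp only [dif_neg h'] at hz
      exact absurd rfl hz

/-- The one-sided basis function at a vertex `z` on the line, in terms of the triangles of `S`. -/
theorem exists_mem_edgeSpace (H : OneSidedSpline Ω T₀ k T h S p) (hT : Conforming T) {t : Plane}
    (ht : h.linear t = 0) {z : Plane} {φ : Plane → ℝ} (hφ : IsNodalBasis k T z φ)
    (hφ0 : ∀ K ∈ T, z ∉ Set.range K.points → ∀ y ∈ K.hull, φ y = 0)
    {L : Tri} (hL : L ∈ S) {i : Fin 3} (hi : L.points i = z) (hz : h z = 0)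
    (hp : evalAt z (p L) ≠ 0) :
    ∃ W ∈ edgeSpace Ω T₀ k T, (∀ M ∈ S, ∀ y, M.Inside y → W y = φ y • outer t) ∧
      ∀ M ∈ T, M ∉ S → ∀ y, M.Inside y → W y = 0 := by
  obtain ⟨v, hv⟩ := H.ne_zero
  subst hi
  obtain ⟨hzΩ, hz₀, K, hK, hKz, h0, h1⟩ := H.vertex L hL i hz hp
  obtain ⟨γ, hγ, hin⟩ := K.exists_inner_normal hv h0 h1
  obtain ⟨a, ha⟩ := exists_outer_eq (linear_ne_zero hv h0) K.edgeTangent_ne_zero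
    (K.linear_edgeTangent (h0.trans h1.symm)) ht
  -- the normal that points to the side of `S`
  obtain ⟨n, hn, δ, hδ, hnδ⟩ : ∃ n, (n = perp (edgeTangent K) ∨ n = -perp (edgeTangent K)) ∧
      ∃ δ : ℝ, 0 < δ ∧ ∀ y, inner ℝ (y - L.points i) n = δ * h y := by
    rcases lt_or_gt_of_ne hγ with hlt | hgt
    · exact ⟨_, .inr rfl, -γ, neg_pos.2 hlt, fun y => by
        rw [inner_neg_right, hin, hz, sub_zero, neg_mul]⟩
    · exact ⟨_, .inl rfl, γ, hgt, fun y => by rw [hin, hz, sub_zero]⟩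
  have hgen : oneSided (sidePatch T (L.points i) n) φ (edgeTangent K) ∈ edgeSpace Ω T₀ k T := by
    refine Submodule.subset_span ⟨L.points i, ⟨⟨⟨L, H.subset hL, i, rfl⟩, hzΩ⟩, hz₀⟩, K, hK, hKz,
      φ, hφ, ?_⟩
    rcases hn with rfl | rfl
    exacts [.inl rfl, .inr rfl]
  refine ⟨_, Submodule.smul_mem _ a hgen, fun M hM y hy => ?_, fun M hM hMS y hy => ?_⟩
  · rw [Pi.smul_apply, oneSided]
    by_cases hzM : L.points i ∈ M.hull
    · rw [Set.indicator_of_mem, ha, smul_comm]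
      refine Set.mem_biUnion (x := M) ⟨H.subset hM, hzM, ?_⟩ hy.mem_hull
      rw [hnδ]
      exact mul_pos hδ (M.pos_of_inside (H.nonneg M hM) hv M.inside_mid)
    · have hφy : φ y = 0 := hφ0 M (H.subset hM)
        (fun ⟨j, hj⟩ => hzM (hj ▸ M.points_mem_hull j)) y hy.mem_hull
      rw [hφy, zero_smul]
      by_cases hyW : y ∈ sidePatch T (L.points i) n
      · rw [Set.indicator_of_mem hyW, hφy, zero_smul, smul_zero]
      · rw [Set.indicator_of_notMem hyW, smul_zero]
  · rw [Pi.smul_apply, oneSided, Set.indicator_of_notMem, smul_zero]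
    intro hyW
    obtain ⟨N, ⟨hN, hzN, hmid⟩, hyN⟩ := Set.mem_iUnion₂.1 hyW
    obtain rfl := hT.eq_of_inside hM hN hy hyN
    have hneg := H.nonpos L hL N hM hMS _ (L.points_mem_hull i) hzN hp
    rw [hnδ] at hmid
    have h3 := N.nonpos_of_mem_hull hneg N.inside_mid.mem_hull
    nlinarith

/-- The key decomposition. Subtracting the one-sided basis functions at the vertices on the line,
and then the bubbles of the edges on the line, leaves a piecewise polynomial that vanishes on the
line, hence is continuous. -/
theorem decomposable (H : OneSidedSpline Ω T₀ k T h S p) (hT : IsTriangulation Ω T) (hk : 2 ≤ k)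
    {t : Plane} (ht : h.linear t = 0) {τ : MatField}
    (hτS : ∀ L ∈ S, ∀ y, L.Inside y → τ y = evalAt y (p L) • outer t)
    (hτ0 : ∀ L ∈ T, L ∉ S → ∀ y, L.Inside y → τ y = 0) : Decomposable Ω T₀ k T τ := by
  classical
  obtain ⟨v, hv⟩ := H.ne_zero
  have hkpos : 0 < k := by omega
  have hfin : (vertices T).Finite := by
    have : vertices T = ⋃ K ∈ T, Set.range K.points := by
      ext z; simp [vertices]
    rw [this]
    exact hT.1.biUnion fun K _ => Set.finite_range _
  obtain ⟨β, hβS, hβ⟩ := H.exists_trace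
  choose! φ hφ hφv hφ0 using fun z (hz : z ∈ vertices T) => hT.2.1.exists_isNodalBasis hkpos hz
  -- the part in `E(T)` removes the values at the vertices on the line
  have hW : ∀ z ∈ vertices T, ∃ W ∈ edgeSpace Ω T₀ k T,
      (∀ M ∈ S, ∀ y, M.Inside y → W y = (β z * φ z y) • outer t) ∧
      ∀ M ∈ T, M ∉ S → ∀ y, M.Inside y → W y = 0 := by
    intro z hz
    by_cases hβz : β z = 0
    · exact ⟨0, Submodule.zero_mem _, fun M _ y _ => by simp [hβz], fun M _ _ y _ => rfl⟩
    · obtain ⟨hz0, L, hL, i, hi, hne⟩ := hβ z hβz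
      obtain ⟨W, h1, h2, h3⟩ :=
        H.exists_mem_edgeSpace hT.2.1 ht (hφ z hz) (hφ0 z hz) hL hi hz0 hne
      refine ⟨β z • W, Submodule.smul_mem _ _ h1, fun M hM y hy => ?_, fun M hM hMS y hy => ?_⟩
      · rw [Pi.smul_apply, h2 M hM y hy, smul_smul]
      · rw [Pi.smul_apply, h3 M hM hMS y hy, smul_zero]
  choose! W hWE hWS hW0 using hW
  set c : Tri → Poly := fun L => ∑ i, MvPolynomial.C (β (L.points i)) * L.vertexPoly k i with hc
  have hc_eval : ∀ L y, evalAt y (c L) =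
      ∑ i, β (L.points i) * (nodalPoly k).eval (L.bary i y) := by
    intro L y
    simp only [← L.evalAt_vertexPoly]
    simp [hc, evalAt]
  have hsum : ∀ L ∈ T, ∀ y ∈ L.hull, ∑ z ∈ hfin.toFinset, β z * φ z y = evalAt y (c L) := by
    intro L hL y hy
    have hsub : Finset.univ.image L.points ⊆ hfin.toFinset := by
      intro z hz
      obtain ⟨i, -, rfl⟩ := Finset.mem_image.1 hz
      exact hfin.mem_toFinset.2 ⟨L, hL, i, rfl⟩
    rw [← Finset.sum_subset hsub, Finset.sum_image fun i _ j _ hij => L.points_injective hij,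
      hc_eval]
    · refine Finset.sum_congr rfl fun i _ => ?_
      rw [hφv _ ⟨L, hL, i, rfl⟩ L hL i rfl y hy, L.evalAt_vertexPoly]
    · intro z hz hzL
      rw [hφ0 z (hfin.mem_toFinset.1 hz) L hL (fun ⟨i, hi⟩ => hzL (Finset.mem_image.2
        ⟨i, Finset.mem_univ i, hi⟩)) y hy, mul_zero]
  have hc_deg : ∀ L, (c L).totalDegree ≤ k := fun L =>
    MvPolynomial.totalDegree_finsetSum_le fun i _ => by
      refine (MvPolynomial.totalDegree_mul _ _).trans ?_
      rw [MvPolynomial.totalDegree_C, zero_add]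
      exact L.totalDegree_vertexPoly k i
  have hpc_deg : ∀ L ∈ S, (p L - c L).totalDegree ≤ k := fun L hL =>
    (MvPolynomial.totalDegree_sub _ _).trans (max_le (H.degree L hL) (hc_deg L))
  have hpc_vertex : ∀ L ∈ S, ∀ i, h (L.points i) = 0 →
      evalAt (L.points i) (p L - c L) = 0 := by
    intro L hL i hi
    have h1 : evalAt (L.points i) (c L) = β (L.points i) := by
      rw [hc_eval, Finset.sum_eq_single i]
      · rw [bary_points, if_pos rfl, eval_nodalPoly_one, mul_one]
      · intro j _ hj
        rw [bary_points, if_neg hj, eval_nodalPoly_zero hkpos, mul_zero]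
      · simp
    have h2 : evalAt (L.points i) (p L - c L) =
        evalAt (L.points i) (p L) - evalAt (L.points i) (c L) := by simp [evalAt]
    rw [h2, h1, hβS L hL i hi, sub_self]
  -- the bubbles remove the values on the edges on the line
  choose! I J q hIJ hq hqIJ hqe using fun L (hL : L ∈ S) =>
    L.exists_edgeBubble_eq hv (H.nonneg L hL) (hpc_deg L hL) (hpc_vertex L hL)
  set b : Tri → Poly := fun L => L.baryPoly (I L) * L.baryPoly (J L) * q L with hb
  have hb_eval : ∀ L y, evalAt y (b L) = L.edgeBubble (I L) (J L) (q L) y := fun L y => by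
    simp only [edgeBubble, ← L.evalAt_baryPoly]
    simp [hb, evalAt]
  have hb_deg : ∀ L ∈ S, (b L).totalDegree ≤ k := fun L hL => by
    have h1 := MvPolynomial.totalDegree_mul (L.baryPoly (I L) * L.baryPoly (J L)) (q L)
    have h2 := MvPolynomial.totalDegree_mul (L.baryPoly (I L)) (L.baryPoly (J L))
    have h3 := L.totalDegree_baryPoly (I L)
    have h4 := L.totalDegree_baryPoly (J L)
    have h5 := hq L hL
    simp only [hb]
    omega
  -- a bubble is nonzero at a point of another triangle only if that triangle is across the line
  have hb_ne : ∀ L ∈ S, ∀ M ∈ T, M ≠ L → ∀ y ∈ L.hull, y ∈ M.hull → evalAt y (b L) ≠ 0 →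
      ∀ i, h (M.points i) ≤ 0 := by
    intro L hL M hM hML y hyL hyM hne
    rw [hb_eval, edgeBubble] at hne
    have hq0 : q L ≠ 0 := fun h0 => hne (by rw [h0]; simp [evalAt])
    obtain ⟨hI0, hJ0⟩ := hqIJ L hL hq0
    obtain ⟨d, hdI, hdJ, hd⟩ := exists_third (hIJ L hL)
    have hd0 : ∀ i, i ≠ d → h (L.points i) = 0 := fun i hi => by
      rcases hd i hi with rfl | rfl
      exacts [hI0, hJ0]
    have hpos := L.pos_of_edge_eq_zero hv (H.nonneg L hL d) hd0
    refine (hT.2.1.edge_neighbor (H.subset hL) hM hML hd0 hpos hyL hyM fun i hi => ?_).1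
    refine lt_of_le_of_ne ((L.mem_hull_iff y).1 hyL i) fun h0 => hne ?_
    rcases hd i hi with rfl | rfl <;> simp [← h0]
  -- a triangle of the mesh on the negative side does not belong to `S`
  have hneg_S : ∀ M ∈ S, ¬ ∀ i, h (M.points i) ≤ 0 := by
    intro M hM hneg
    obtain ⟨i, hi⟩ := M.exists_ne_zero hv
    exact hi (le_antisymm (hneg i) (H.nonneg M hM i))
  set r : Tri → Poly := fun L => if L ∈ S then p L - c L - b L else 0 with hr
  have hr_eval : ∀ L ∈ S, ∀ y, evalAt y (r L) =
      evalAt y (p L) - evalAt y (c L) - evalAt y (b L) := fun L hL y => by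
    simp only [hr, if_pos hL]
    simp [evalAt]
  have hr_out : ∀ L ∈ S, ∀ M ∈ T, M ∉ S → ∀ y ∈ L.hull, y ∈ M.hull → evalAt y (r L) = 0 := by
    intro L hL M hM hMS y hyL hyM
    have hML : M ≠ L := fun h' => hMS (h' ▸ hL)
    have hnn : 0 ≤ h y := L.nonneg_of_mem_hull (H.nonneg L hL) hyL
    by_cases hy0 : h y = 0
    · have h1 := hqe L hL y hyL hy0
      have h2 : evalAt y (p L - c L) = evalAt y (p L) - evalAt y (c L) := by simp [evalAt]
      rw [hr_eval L hL, hb_eval, ← h1, h2, sub_self]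
    · have hM_neg : ¬ ∀ i, h (M.points i) ≤ 0 := by
        intro hneg
        exact hy0 (le_antisymm (M.nonpos_of_mem_hull hneg hyM) hnn)
      have h1 : evalAt y (p L) = 0 := by
        by_contra hne
        exact hM_neg (H.nonpos L hL M hM hMS y hyL hyM hne)
      have h2 : evalAt y (b L) = 0 := by
        by_contra hne
        exact hM_neg (hb_ne L hL M hM hML y hyL hyM hne)
      have h3 : evalAt y (c L) = 0 := by
        rw [hc_eval]
        refine Finset.sum_eq_zero fun i _ => ?_
        by_cases hbi : L.bary i y = 0
        · rw [hbi, eval_nodalPoly_zero hkpos, mul_zero]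
        obtain ⟨j, hj, -⟩ := hT.2.1.exists_common (H.subset hL) hM hyL hyM hbi
        by_cases hβi : β (L.points i) = 0
        · rw [hβi, zero_mul]
        obtain ⟨hz0, -⟩ := hβ _ hβi
        rw [hβS L hL i hz0] at hβi
        exact absurd (H.nonpos L hL M hM hMS _ (L.points_mem_hull i)
          (hj ▸ M.points_mem_hull j) hβi) hM_neg
      rw [hr_eval L hL, h1, h2, h3]; simp
  have hr_notMem : ∀ L, L ∉ S → ∀ y, evalAt y (r L) = 0 := fun L hL y => by
    simp [hr, hL, evalAt]
  have hcont : Decomposable Ω T₀ k T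
      (fun y => (∑ L ∈ hT.1.toFinset, L.hull.indicator (fun y => evalAt y (r L)) y) • outer t) := by
    refine hT.decomposable_of_agree (r := r) (fun L _ => ?_) (fun L hL M hM y hyL hyM => ?_)
      (outer_isSymm t) fun L hL y hy => ?_
    · by_cases hLS : L ∈ S
      · simp only [hr, if_pos hLS]
        exact (MvPolynomial.totalDegree_sub _ _).trans (max_le (hpc_deg L hLS) (hb_deg L hLS))
      · simp [hr, hLS]
    · by_cases hLS : L ∈ S
      · by_cases hMS : M ∈ S
        · by_cases hML : M = L
          · rw [hML]
          have h1 : evalAt y (b L) = 0 := by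
            by_contra hne
            exact hneg_S M hMS (hb_ne L hLS M hM hML y hyL hyM hne)
          have h2 : evalAt y (b M) = 0 := by
            by_contra hne
            exact hneg_S L hLS (hb_ne M hMS L hL (Ne.symm hML) y hyM hyL hne)
          rw [hr_eval L hLS, hr_eval M hMS, h1, h2, H.agree L hLS M hMS y hyL hyM,
            ← hsum L hL y hyL, ← hsum M hM y hyM]
        · rw [hr_out L hLS M hM hMS y hyL hyM, hr_notMem M hMS]
      · by_cases hMS : M ∈ S
        · rw [hr_out M hMS L hL hLS y hyM hyL, hr_notMem L hLS]
        · rw [hr_notMem L hLS, hr_notMem M hMS]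
    · rw [hT.sum_indicator_eq (fun L y => evalAt y (r L)) hL hy]
  have hbub : Decomposable Ω T₀ k T (fun y => ∑ L ∈ hT.1.toFinset,
      L.hull.indicator (fun y => if L ∈ S then evalAt y (b L) • outer t else 0) y) := by
    refine hT.decomposable_of_isBubbleOn fun L hL => ?_
    have hin := fun y (hy : L.Inside y) => hT.sum_indicator_eq
      (fun L y => if L ∈ S then evalAt y (b L) • outer t else 0) hL hy
    by_cases hLS : L ∈ S
    · by_cases hq0 : q L = 0
      · refine L.isBubbleOn_of_edge (hIJ L hLS) (hq L hLS) fun y hy => ?_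
        rw [hin y hy, if_pos hLS, hb_eval, hq0]
        simp [edgeBubble, evalAt]
      · obtain ⟨h1, h2⟩ := hqIJ L hLS hq0
        refine L.isBubbleOn_of_tangent hv (hIJ L hLS) h1 h2 ht (hq L hLS) fun y hy => ?_
        rw [hin y hy, if_pos hLS, hb_eval]
    · refine L.isBubbleOn_of_edge (i := 0) (j := 1) (q := 0) (by decide) (by simp) fun y hy => ?_
      rw [hin y hy, if_neg hLS]
      simp [edgeBubble, evalAt]
  have hedge : Decomposable Ω T₀ k T (∑ z ∈ hfin.toFinset, W z) :=
    hT.decomposable_of_mem_edgeSpace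
      (Submodule.sum_mem _ fun z hz => hWE z (hfin.mem_toFinset.1 hz))
  refine ((hcont.add hbub).add hedge).congr (hT.ae_eq_of_inside fun L hL y hy => ?_)
  simp only [Pi.add_apply]
  rw [hT.sum_indicator_eq (fun L y => evalAt y (r L)) hL hy, hT.sum_indicator_eq
    (fun L y => if L ∈ S then evalAt y (b L) • outer t else 0) hL hy, Finset.sum_apply]
  by_cases hLS : L ∈ S
  · rw [if_pos hLS, hτS L hLS y hy, hr_eval L hLS, Finset.sum_congr rfl fun z hz =>
      hWS z (hfin.mem_toFinset.1 hz) L hLS y hy, ← Finset.sum_smul, hsum L hL y hy.mem_hull,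
      ← add_smul, ← add_smul]
    congr 1
    ring
  · rw [if_neg hLS, hτ0 L hL hLS y hy, hr_notMem L hLS, Finset.sum_congr rfl fun z hz =>
      hW0 z (hfin.mem_toFinset.1 hz) L hL hLS y hy]
    simp

end OneSidedSpline

/-! ### Transfer to a refinement -/

theorem Tri.mem_hull_of_edge {N M : Tri} {a b : Fin 3} (hab : a ≠ b) {z : Plane}
    (hz : z ∈ N.hull) (h0 : ∀ l, l ≠ a → l ≠ b → N.bary l z = 0) (ha : N.points a ∈ M.hull)
    (hb : N.points b ∈ M.hull) : z ∈ M.hull := by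
  obtain ⟨h1, h2⟩ := N.eq_add_smul_of_edge hab h0
  have hza := (N.mem_hull_iff z).1 hz a
  have hzb := (N.mem_hull_iff z).1 hz b
  rw [h2]
  exact M.convex_hull.add_smul_sub_mem ha hb ⟨hzb, by linarith⟩

theorem Tri.not_vertex_of_bary_ne_zero (N : Tri) {a b : Fin 3} (hab : a ≠ b) {z : Plane}
    (ha : N.bary a z ≠ 0) (hb : N.bary b z ≠ 0) : z ∉ Set.range N.points := by
  rintro ⟨i, rfl⟩
  rw [bary_points] at ha hb
  simp only [ne_eq, ite_eq_right_iff, one_ne_zero, imp_false, not_not] at ha hb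
  exact hab (ha.trans hb.symm)

section Refinement

variable {Ω : Set Plane} {T₀ T T' : Set Tri} {k : ℕ}

theorem exists_refMid_of_new_vertex (hT : T ∈ admissible T₀) {N L : Tri} (hN : N ∈ T)
    (hd : Desc N L) {h : Plane →ᵃ[ℝ] ℝ} (hNn : ∀ i, 0 ≤ h (N.points i)) {i : Fin 3}
    (hz : h (L.points i) = 0) (hzN : L.points i ∉ Set.range N.points) :
    L.points i ∉ vertices T₀ ∧
      ∃ K, Generated T₀ K ∧ K.refMid = L.points i ∧ h (K.points 0) = 0 ∧ h (K.points 1) = 0 := by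
  refine ⟨fun h0 => hzN (hT.2.mem_range_of_mem_vertices hN (hT.1.vertices_subset h0)
    (Desc.hull_subset hd (L.points_mem_hull i))), ?_⟩
  obtain ⟨K, hK, h1, h2⟩ := Desc.exists_refMid hd hNn ⟨i, rfl⟩ hzN hz
  exact ⟨K, Desc.generated hK (hT.1.generated hN), h1, h2⟩

/-- A bubble of the coarse mesh. If its edge is shared by another triangle, its trace on that edge
is removed with one-sided basis functions; otherwise the bubble is continuous in the closure of the
domain. -/
theorem decomposable_edgeBubble (hT₀ : IsTriangulation Ω T₀) (hk : 2 ≤ k)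
    (hT : T ∈ admissible T₀) (hT' : T' ∈ admissible T₀) (hTT' : Refines T T') {N : Tri}
    (hN : N ∈ T) {a b : Fin 3} (hab : a ≠ b) {q : Poly} (hq : q.totalDegree ≤ k - 2) :
    Decomposable Ω T₀ k T'
      fun y => N.hull.indicator (N.edgeBubble a b q) y • outer (N.points b - N.points a) := by
  classical
  have hTt := hT₀.of_admissible hT
  have hTt' := hT₀.of_admissible hT'
  obtain ⟨c, hca, hcb, hc⟩ := exists_third hab
  set h := N.baryMap c with hh
  have hc0 : ∀ i, i ≠ c → h (N.points i) = 0 := fun i hi => by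
    rw [hh, baryMap_apply, bary_points, if_neg hi.symm]
  have hc1 : h (N.points c) = 1 := by rw [hh, baryMap_apply, bary_points, if_pos rfl]
  have hNn : ∀ i, 0 ≤ h (N.points i) := fun i => (N.mem_hull_iff _).1 (N.points_mem_hull i) c
  set p : Poly := N.baryPoly a * N.baryPoly b * q with hp
  have hp_eval : ∀ y, evalAt y p = N.edgeBubble a b q y := fun y => by
    simp only [edgeBubble, ← N.evalAt_baryPoly]
    simp [hp, evalAt]
  have hp_deg : p.totalDegree ≤ k := by
    have h1 := MvPolynomial.totalDegree_mul (N.baryPoly a * N.baryPoly b) q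
    have h2 := MvPolynomial.totalDegree_mul (N.baryPoly a) (N.baryPoly b)
    have h3 := N.totalDegree_baryPoly a
    have h4 := N.totalDegree_baryPoly b
    rw [hp]
    omega
  have hp_pos : ∀ y ∈ N.hull, evalAt y p ≠ 0 → ∀ i, i ≠ c → 0 < N.bary i y := by
    intro y hy hne i hi
    refine lt_of_le_of_ne ((N.mem_hull_iff y).1 hy i) fun h0 => hne ?_
    rw [hp_eval]
    rcases hc i hi with rfl | rfl <;> simp [edgeBubble, ← h0]
  set S : Set Tri := {L | L ∈ T' ∧ Desc N L} with hS
  have hsub : ∀ L ∈ S, L.hull ⊆ N.hull := fun L hL => Desc.hull_subset hL.2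
  have hother : ∀ M ∈ T', M ∉ S → ∃ M₀ ∈ T, M₀ ≠ N ∧ M.hull ⊆ M₀.hull := by
    intro M hM hMS
    obtain ⟨M₀, hM₀, hd⟩ := hTT'.exists_desc hM
    refine ⟨M₀, hM₀, ?_, Desc.hull_subset hd⟩
    rintro rfl
    exact hMS ⟨hM, hd⟩
  have hτS : ∀ L ∈ S, ∀ y, L.Inside y → N.hull.indicator (N.edgeBubble a b q) y •
      outer (N.points b - N.points a) = evalAt y p • outer (N.points b - N.points a) := by
    intro L hL y hy
    rw [Set.indicator_of_mem (hsub L hL hy.mem_hull), hp_eval]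
  have hτ0 : ∀ L ∈ T', L ∉ S → ∀ y, L.Inside y → N.hull.indicator (N.edgeBubble a b q) y •
      outer (N.points b - N.points a) = 0 := by
    intro L hL hLS y hy
    obtain ⟨M₀, hM₀, hne, hs⟩ := hother L hL hLS
    rw [Set.indicator_of_notMem, zero_smul]
    exact fun hyN => hne (hT.2.eq_of_inside hM₀ hN (inside_of_hull_subset hs hy) hyN).symm
  by_cases hshare : ∃ M ∈ T, M ≠ N ∧ ∃ y ∈ N.hull, y ∈ M.hull ∧ evalAt y p ≠ 0
  · obtain ⟨M₁, hM₁, hM₁N, y₁, hy₁N, hy₁M, hy₁⟩ := hshare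
    have hcommon : ∀ i, i ≠ c → N.points i ∈ M₁.hull := fun i hi => by
      obtain ⟨j, hj, -⟩ := hT.2.exists_common hN hM₁ hy₁N hy₁M (hp_pos y₁ hy₁N hy₁ i hi).ne'
      exact hj ▸ M₁.points_mem_hull j
    have H : OneSidedSpline Ω T₀ k T' h S fun _ => p := by
      refine ⟨fun L hL => hL.1, ⟨N.points c, by simp [hc1]⟩, fun _ _ => hp_deg,
        fun L hL i => N.nonneg_of_mem_hull hNn (hsub L hL (L.points_mem_hull i)),
        fun _ _ _ _ _ _ _ => rfl, fun L hL M hM hMS y hyL hyM hne i => ?_,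
        fun L hL i hz hne => ?_⟩
      · obtain ⟨M₀, hM₀, hM₀N, hs⟩ := hother M hM hMS
        have hyN := hsub L hL hyL
        exact M₀.nonpos_of_mem_hull (hT.2.edge_neighbor hN hM₀ hM₀N hc0 (by simp [hc1]) hyN
          (hs hyM) (hp_pos y hyN hne)).1 (hs (M.points_mem_hull i))
      · have hzN := hsub L hL (L.points_mem_hull i)
        have hpos := hp_pos _ hzN hne
        have hzM : L.points i ∈ M₁.hull := mem_hull_of_edge hab hzN (fun l hla hlb => by
          have : l = c := by
            by_contra hlc
            rcases hc l hlc with rfl | rfl <;> contradiction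
          rw [this]; exact hz) (hcommon a hca.symm) (hcommon b hcb.symm)
        refine ⟨hTt.interior_meshUnion ▸ (hT.2.edge_neighbor hN hM₁ hM₁N hc0 (by simp [hc1]) hzN
          hzM hpos).2, exists_refMid_of_new_vertex hT hN hL.2 hNn hz
          (N.not_vertex_of_bary_ne_zero hab (hpos a hca.symm).ne' (hpos b hcb.symm).ne')⟩
    refine H.decomposable hTt' hk (t := N.points b - N.points a) ?_ hτS hτ0
    rw [affine_linear_sub, hc0 a hca.symm, hc0 b hcb.symm, sub_zero]
  · push Not at hshare
    have hzero : ∀ L ∈ S, ∀ M ∈ T', M ∉ S → ∀ y ∈ L.hull, y ∈ M.hull → evalAt y p = 0 := by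
      intro L hL M hM hMS y hyL hyM
      obtain ⟨M₀, hM₀, hM₀N, hs⟩ := hother M hM hMS
      exact hshare M₀ hM₀ hM₀N y (hsub L hL hyL) (hs hyM)
    refine hTt'.decomposable_of_agree (r := fun L => if L ∈ S then p else 0) (fun L _ => ?_)
      (fun L hL M hM y hyL hyM => ?_) (outer_isSymm (N.points b - N.points a))
      fun L hL y hy => ?_
    · split_ifs
      · exact hp_deg
      · simp
    · by_cases hLS : L ∈ S <;> by_cases hMS : M ∈ S
      · simp only [if_pos hLS, if_pos hMS]
      · simp only [if_pos hLS, if_neg hMS, hzero L hLS M hM hMS y hyL hyM]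
        simp [evalAt]
      · simp only [if_neg hLS, if_pos hMS, hzero M hMS L hL hLS y hyM hyL]
        simp [evalAt]
      · simp only [if_neg hLS, if_neg hMS]
    · by_cases hLS : L ∈ S
      · simp only [if_pos hLS, hτS L hLS y hy]
      · simp only [if_neg hLS, hτ0 L hL hLS y hy]
        simp [evalAt]

/-- An edge of the mesh that starts at a point of `Ω` belongs to a second triangle. -/
theorem exists_ne_mem_hull (hTt : IsTriangulation Ω T) {N : Tri}
    {h : Plane →ᵃ[ℝ] ℝ} (hNn : ∀ i, 0 ≤ h (N.points i)) {c : Fin 3} (hc : 0 < h (N.points c))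
    {y : Plane} (hy : y ∈ Ω) (hy0 : h y = 0) : ∃ M ∈ T, M ≠ N ∧ y ∈ M.hull := by
  by_contra! hcon
  have hcl : IsClosed (⋃ M ∈ T \ {N}, M.hull) :=
    hTt.1.sdiff.isClosed_biUnion fun M _ => M.isClosed_hull
  have hyc : y ∈ (⋃ M ∈ T \ {N}, M.hull)ᶜ := by
    intro hmem
    obtain ⟨M, hM, hyM⟩ := Set.mem_iUnion₂.1 hmem
    exact hcon M hM.1 hM.2 hyM
  have hnear : ∀ᶠ w in nhds y, w ∈ N.hull := by
    filter_upwards [hcl.isOpen_compl.mem_nhds hyc, hTt.isOpen.mem_nhds hy] with w hw hwΩ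
    obtain ⟨M, hM, hwM⟩ := Set.mem_iUnion₂.1 (hTt.subset_meshUnion hwΩ)
    by_cases hMN : M = N
    · exact hMN ▸ hwM
    · exact absurd (Set.mem_biUnion (show M ∈ T \ {N} from ⟨hM, hMN⟩) hwM) hw
  -- move away from the triangle
  obtain ⟨s, hs0, -, hs⟩ := exists_lineMap_of_eventually hnear
    (AffineMap.lineMap y (N.points c) (-1 : ℝ))
  have := N.nonneg_of_mem_hull hNn hs
  rw [affine_lineMap, affine_lineMap, hy0] at this
  nlinarith

/-- The generators of `E(T)` for the coarse mesh. -/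
theorem decomposable_oneSided (hT₀ : IsTriangulation Ω T₀) (hk : 2 ≤ k)
    (hT : T ∈ admissible T₀) (hT' : T' ∈ admissible T₀) (hTT' : Refines T T') {x : Plane}
    (hx : x ∈ (vertices T ∩ Ω) \ vertices T₀) {K : Tri} (hK : Generated T₀ K)
    (hKx : K.refMid = x) {φ : Plane → ℝ} (hφ : IsNodalBasis k T x φ) {n : Plane}
    (hn : n = perp (edgeTangent K) ∨ n = -perp (edgeTangent K)) :
    Decomposable Ω T₀ k T' (oneSided (sidePatch T x n) φ (edgeTangent K)) := by
  classical
  have hTt := hT₀.of_admissible hT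
  have hTt' := hT₀.of_admissible hT'
  -- an affine function `h` which is a positive multiple of the coordinate in the direction `n`
  obtain ⟨h, δ, hδ, hnδ, ⟨v, hv⟩, hK0, hK1, hside⟩ : ∃ (h : Plane →ᵃ[ℝ] ℝ) (δ : ℝ), 0 < δ ∧
      (∀ y, inner ℝ (y - x) n = δ * h y) ∧ (∃ v, h v ≠ 0) ∧ h (K.points 0) = 0 ∧
      h (K.points 1) = 0 ∧ ∀ N ∈ T, x ∈ N.hull →
        (∀ i, 0 ≤ h (N.points i)) ∨ ∀ i, h (N.points i) ≤ 0 := by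
    have h0 : K.baryMap 2 (K.points 0) = 0 := by rw [baryMap_apply, bary_points]; simp
    have h1 : K.baryMap 2 (K.points 1) = 0 := by rw [baryMap_apply, bary_points]; simp
    have h2 : K.baryMap 2 (K.points 2) ≠ 0 := by rw [baryMap_apply, bary_points]; simp
    have hx0 : K.baryMap 2 x = 0 := by rw [← hKx, baryMap_apply, bary_refMid, if_pos rfl]
    have hs : ∀ N ∈ T, x ∈ N.hull → (∀ i, 0 ≤ K.baryMap 2 (N.points i)) ∨
        ∀ i, K.baryMap 2 (N.points i) ≤ 0 := fun N hN hxN =>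
      one_sided_of_mem hT hK (hKx ▸ hx.1.1) hN (hKx ▸ hxN)
    obtain ⟨γ, hγ, hin⟩ := K.exists_inner_normal h2 h0 h1
    obtain ⟨γ', hγ', hin'⟩ : ∃ γ' : ℝ, γ' ≠ 0 ∧ ∀ y, inner ℝ (y - x) n = γ' * K.baryMap 2 y := by
      rcases hn with rfl | rfl
      · exact ⟨γ, hγ, fun y => by rw [hin, hx0, sub_zero]⟩
      · exact ⟨-γ, neg_ne_zero.2 hγ, fun y => by
          rw [inner_neg_right, hin, hx0, sub_zero, neg_mul]⟩
    rcases lt_or_gt_of_ne hγ' with hlt | hgt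
    · refine ⟨-K.baryMap 2, -γ', neg_pos.2 hlt, fun y => ?_, ⟨K.points 2, ?_⟩, ?_, ?_,
        fun N hN hxN => ?_⟩
      · rw [hin', neg_affine_apply]; ring
      · rw [neg_affine_apply]; exact neg_ne_zero.2 h2
      · rw [neg_affine_apply, h0, neg_zero]
      · rw [neg_affine_apply, h1, neg_zero]
      · simp only [neg_affine_apply, Left.nonneg_neg_iff, Left.neg_nonpos_iff]
        exact (hs N hN hxN).symm
    · exact ⟨_, γ', hgt, hin', ⟨_, h2⟩, h0, h1, hs⟩
  have hx0 : h x = 0 := by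
    have := hnδ x
    rw [sub_self, inner_zero_left] at this
    exact (mul_eq_zero.1 this.symm).resolve_left hδ.ne'
  set P : Set Tri := {N | N ∈ T ∧ x ∈ N.hull ∧ 0 < inner ℝ (N.mid - x) n} with hP
  have hPn : ∀ N ∈ P, ∀ i, 0 ≤ h (N.points i) := by
    rintro N ⟨hN, hxN, hmid⟩
    refine (hside N hN hxN).resolve_right fun hneg => ?_
    have := N.nonpos_of_mem_hull hneg N.inside_mid.mem_hull
    rw [hnδ] at hmid
    nlinarith
  have hPo : ∀ N ∈ T, N ∉ P → x ∈ N.hull → ∀ i, h (N.points i) ≤ 0 := by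
    intro N hN hNP hxN
    refine (hside N hN hxN).resolve_left fun hnn => hNP ⟨hN, hxN, ?_⟩
    rw [hnδ]
    exact mul_pos hδ (N.pos_of_inside hnn hv N.inside_mid)
  have hopp : ∀ N ∈ T, ∀ a, N.points a = x → ∀ y ∈ N.hull, N.bary a y = 0 → φ y = 0 := by
    intro N hN a ha y hy hy0
    obtain ⟨p, hp, hpe⟩ := hφ.1 N hN
    rw [hpe y hy]
    refine N.eq_zero_on_opposite_edge (by omega) hp (fun z hz hza => ?_) hy0
    have hzN : z ∈ N.hull := by
      obtain ⟨w, hw, rfl⟩ := hz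
      refine N.sum_smul_mem_hull (fun i => by positivity) ?_
      rw [← Finset.sum_div, ← Nat.cast_sum, hw, div_self]
      exact_mod_cast (by omega : k ≠ 0)
    rw [← hpe z hzN]
    exact hφ.2.2 N hN z hz (ha ▸ hza)
  set S : Set Tri := {L | L ∈ T' ∧ ∃ N ∈ P, Desc N L} with hS
  have hpoly : ∀ L ∈ S, ∃ p : Poly, p.totalDegree ≤ k ∧ ∀ y ∈ L.hull, φ y = evalAt y p := by
    rintro L ⟨-, N, hN, hd⟩
    obtain ⟨p, hp, hpe⟩ := hφ.1 N hN.1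
    exact ⟨p, hp, fun y hy => hpe y (Desc.hull_subset hd hy)⟩
  choose! p hp hpe using hpoly
  have hother : ∀ M ∈ T', M ∉ S → ∃ M₀ ∈ T, M₀ ∉ P ∧ M.hull ⊆ M₀.hull := by
    intro M hM hMS
    obtain ⟨M₀, hM₀, hd⟩ := hTT'.exists_desc hM
    exact ⟨M₀, hM₀, fun h' => hMS ⟨hM, M₀, h', hd⟩, Desc.hull_subset hd⟩
  have H : OneSidedSpline Ω T₀ k T' h S p := by
    refine ⟨fun L hL => hL.1, ⟨v, hv⟩, hp, ?_, fun L hL M hM y hyL hyM => ?_, ?_, ?_⟩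
    · rintro L ⟨-, N, hN, hd⟩ i
      exact N.nonneg_of_mem_hull (hPn N hN) (Desc.hull_subset hd (L.points_mem_hull i))
    · rw [← hpe L hL y hyL, ← hpe M hM y hyM]
    · intro L hL M hM hMS y hyL hyM hne i
      rw [← hpe L hL y hyL] at hne
      obtain ⟨-, N, hN, hd⟩ := hL
      obtain ⟨M₀, hM₀, hM₀P, hs⟩ := hother M hM hMS
      refine M₀.nonpos_of_mem_hull (hPo M₀ hM₀ hM₀P ?_) (hs (M.points_mem_hull i))
      obtain ⟨a, ha⟩ := hT.2.mem_range_of_mem_vertices hN.1 hx.1.1 hN.2.1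
      have hyN := Desc.hull_subset hd hyL
      obtain ⟨j, hj, -⟩ := hT.2.exists_common hN.1 hM₀ hyN (hs hyM)
        (fun h0 => hne (hopp N hN.1 a ha y hyN h0))
      exact ha ▸ hj ▸ M₀.points_mem_hull j
    · intro L hL i hz hne
      rw [← hpe L hL _ (L.points_mem_hull i)] at hne
      obtain ⟨hLT', N, hN, hd⟩ := hL
      by_cases hzx : L.points i = x
      · rw [hzx]
        exact ⟨hx.1.2, hx.2, K, hK, hKx, hK0, hK1⟩
      obtain ⟨a, ha⟩ := hT.2.mem_range_of_mem_vertices hN.1 hx.1.1 hN.2.1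
      have hzN := Desc.hull_subset hd (L.points_mem_hull i)
      have hza : N.bary a (L.points i) ≠ 0 := fun h0 => hne (hopp N hN.1 a ha _ hzN h0)
      obtain ⟨b, hba, hzb⟩ : ∃ b, b ≠ a ∧ N.bary b (L.points i) ≠ 0 := by
        by_contra! hall
        exact hzx ((N.eq_points_of_bary_eq_zero hall).trans ha)
      have hza' := lt_of_le_of_ne ((N.mem_hull_iff _).1 hzN a) hza.symm
      have hzb' := lt_of_le_of_ne ((N.mem_hull_iff _).1 hzN b) hzb.symm
      obtain ⟨c, hca, hcb, hcc⟩ := exists_third hba.symm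
      have hc0 : ∀ l, l ≠ c → h (N.points l) = 0 := by
        intro l hl
        by_contra hne0
        have hpos := lt_of_le_of_ne (hPn N hN l) (Ne.symm hne0)
        have hbl := N.bary_eq_zero_of_pos (hPn N hN) hzN hz hpos
        rcases hcc l hl with rfl | rfl
        exacts [hza hbl, hzb hbl]
      have hcpos := N.pos_of_edge_eq_zero hv (hPn N hN c) hc0
      have hzc : N.bary c (L.points i) = 0 := N.bary_eq_zero_of_pos (hPn N hN) hzN hz hcpos
      -- a point of the edge that is close to `x`, hence in `Ω`
      obtain ⟨s, hs0, hs1, hsΩ⟩ := exists_lineMap_of_eventually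
        (hTt.isOpen.mem_nhds hx.1.2) (L.points i)
      set y := AffineMap.lineMap x (L.points i) s with hy
      have hyN : y ∈ N.hull := N.convex_hull.lineMap_mem hN.2.1 hzN ⟨hs0.le, hs1.le⟩
      have hy0 : h y = 0 := by rw [hy, affine_lineMap, hz, hx0]; ring
      have hypos : ∀ l, l ≠ c → 0 < N.bary l y := by
        intro l hl
        have hxl := (N.mem_hull_iff _).1 hN.2.1 l
        rw [hy, bary_lineMap]
        rcases hcc l hl with rfl | rfl <;> nlinarith
      obtain ⟨M, hM, hMN, hyM⟩ := exists_ne_mem_hull hTt (hPn N hN) hcpos hsΩ hy0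
      have hcommon : ∀ l, l ≠ c → N.points l ∈ M.hull := fun l hl => by
        obtain ⟨j, hj, -⟩ := hT.2.exists_common hN.1 hM hyN hyM (hypos l hl).ne'
        exact hj ▸ M.points_mem_hull j
      have hzM : L.points i ∈ M.hull := mem_hull_of_edge hba.symm hzN (fun l hla hlb => by
        have : l = c := by
          by_contra hlc
          rcases hcc l hlc with rfl | rfl <;> contradiction
        rw [this]; exact hzc) (hcommon a hca.symm) (hcommon b hcb.symm)
      refine ⟨hTt.interior_meshUnion ▸ (hT.2.edge_neighbor hN.1 hM hMN hc0 hcpos hzN hzM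
        fun l hl => ?_).2, exists_refMid_of_new_vertex hT hN.1 hd (hPn N hN) hz
        (N.not_vertex_of_bary_ne_zero hba.symm hza hzb)⟩
      rcases hcc l hl with rfl | rfl
      exacts [hza', hzb']
  refine H.decomposable hTt' hk (K.linear_edgeTangent (hK0.trans hK1.symm))
    (fun L hL y hy => ?_) (fun L hL hLS y hy => ?_)
  · rw [oneSided, Set.indicator_of_mem, hpe L hL y hy.mem_hull]
    obtain ⟨-, N, hN, hd⟩ := hL
    exact Set.mem_biUnion (x := N) hN (Desc.hull_subset hd hy.mem_hull)
  · rw [oneSided, Set.indicator_of_notMem]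
    intro hyW
    obtain ⟨N, hN, hyN⟩ := Set.mem_iUnion₂.1 hyW
    obtain ⟨M₀, hM₀, hM₀P, hs⟩ := hother L hL hLS
    exact hM₀P (hT.2.eq_of_inside hM₀ hN.1 (inside_of_hull_subset hs hy) hyN ▸ hN)

end Refinement

end NestedStress

theorem mainTheorem2 (Ω : Set NestedStress.Plane) (T₀ : Set NestedStress.Tri)
    (hT₀ : NestedStress.IsTriangulation Ω T₀) (k : ℕ) (hk : 3 ≤ k)
    (T T' : Set NestedStress.Tri) (hT : T ∈ NestedStress.admissible T₀)
    (hT' : T' ∈ NestedStress.admissible T₀) (hTT' : NestedStress.Refines T T') :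
    NestedStress.extendedStressSpace Ω T₀ k T ⊆
      NestedStress.extendedStressSpace Ω T₀ k T' := by
  open NestedStress in
  have hk2 : 2 ≤ k := by omega
  have hTt := hT₀.of_admissible hT
  have hTt' := hT₀.of_admissible hT'
  rintro τ ⟨σ, ⟨-, σc, σb, hσ, hH1, hloc⟩, ε, hε, rfl⟩
  refine Decomposable.mem_extendedStressSpace hTt' (Decomposable.add ?_ ?_)
  · have hc : Decomposable Ω T₀ k T' σc := by
      refine ⟨σc, 0, 0, by simp, hH1, fun L hL => ?_, fun L _ => .zero k L,
        Submodule.zero_mem _⟩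
      obtain ⟨K, hK, hd⟩ := hTT'.exists_desc hL
      exact (hloc K hK).1.mono (Tri.Desc.hull_subset hd)
    obtain ⟨p, hp, hsum⟩ := hTt.exists_ae_eq_sum_edgeBubble fun K hK => (hloc K hK).2
    have hb : Decomposable Ω T₀ k T' σb :=
      Decomposable.congr (Decomposable.sum hTt' fun K hK => Decomposable.sum hTt' fun i _ =>
        Decomposable.sum hTt' fun j hj => decomposable_edgeBubble hT₀ hk2 hT hT' hTT'
          (hTt.1.mem_toFinset.1 hK) (Finset.mem_Ioi.1 hj).ne
          (hp K (hTt.1.mem_toFinset.1 hK) i j)) hsum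
    refine (hc.add hb).congr ?_
    filter_upwards [hσ] with y hy
    rw [hy, Pi.add_apply]
  · unfold edgeSpace at hε
    induction hε using Submodule.span_induction with
    | mem τ hτ =>
      obtain ⟨x, hx, K, hK, hKx, φ, hφ, rfl | rfl⟩ := hτ
      · exact decomposable_oneSided hT₀ hk2 hT hT' hTT' hx hK hKx hφ (.inl rfl)
      · exact decomposable_oneSided hT₀ hk2 hT hT' hTT' hx hK hKx hφ (.inr rfl)
    | zero => exact Decomposable.zero hTt'
    | add _ _ _ _ h1 h2 => exact h1.add h2
    | smul c _ _ h1 => exact h1.smul c
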